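/- All graphs are finite and undirected and may have multiple edges; two parallel edges form a cycle of length $2$. For positive integers $\lambda, N$, $\lambda K_N$ is the loopless multigraph on $N$ vertices in which any two distinct vertices are joined by exactly $\lambda$ edges. For $n\le N$ and $\lambda\le\mu$ we fix an inclusion $\lambda K_n\subseteq\mu K_N$, so that also $\lambda K_n\subseteq \mu K_n\subseteq\mu K_{n+m}$. A *decomposition of size $k$* of a graph $G$ is a sequence $G_1,\dots,G_k$ of spanning subgraphs of $G$, called *colour classes* (isolated vertices and empty edge sets are allowed), whose edge sets are pairwise disjoint and have union $E(G)$. It is a *path decomposition* if every $G_i$ is a union of vertex-disjoint paths (possibly trivial, i.e. single vertices) and cycles; a path decomposition is *strong* if no $G_i$ contains a cycle. It is a *$2$-factorization* if every $G_i$ is $2$-regular, and a *Hamiltonian decomposition* if moreover every $G_i$ is connected. A decomposition $G_1,\dots,G_k$ of $\lambda K_n$ is *enclosed* in a decomposition $H_1,\dots,H_k$ of $\mu K_N$, where $\mu>\lambda$ and $N\ge n$, if $G_i$ is a subgraph of $H_i$ for $1\le i\le k$. **Corollary.** Let $k,n,m,\lambda,\mu$ be positive integers with $\mu>\lambda$,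 and let $\mathcal A$ be a path decomposition of $\lambda K_n$ of size $k$. (a) $\mathcal A$ can be enclosed in a $2$-factorization of $\mu K_{n+m}$ (of size $k$) if and only if - (W1) $k=\mu(n+m-1)/2$ (in particular the right-hand side is an integer), and - (W2) $\mathcal A$ can be enclosed in a path decomposition $\mathcal B$ of $\mu K_n$ of size $k$ in which every colour class has at least $n-m$ edges. (b) If $\mathcal A$ is strong, then $\mathcal A$ can be enclosed in a Hamiltonian decomposition of $\mu K_{n+m}$ (of size $k$) if and only if (W1) holds and $\mathcal A$ can be enclosed in a strong path decomposition $\mathcal B$ of $\mu K_n$ of size $k$ in which every colour class has at least $n-m$ edges. -/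

import Mathlib

open scoped Graph

namespace Enclosing

variable {α β : Type*}

/-- The multigraph `lam K_N`: the vertices are `0, ..., N - 1`, and any two distinct vertices
`x`, `y` are joined by exactly `lam` edges, namely `(s(x, y), 0), ..., (s(x, y), lam - 1)`.
With this labelling `lam K_n` is literally a subgraph of `mu K_{n + m}` when `lam ≤ mu`. -/
def completeMultigraph (lam N : ℕ) : Graph ℕ (Sym2 ℕ × ℕ) where
  vertexSet := {x | x < N}
  IsLink e x y := e.1 = s(x, y) ∧ x ≠ y ∧ x < N ∧ y < N ∧ e.2 < lam
  isLink_symm := fun e _ =>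
    ⟨fun x y h => ⟨h.1.trans Sym2.eq_swap, h.2.1.symm, h.2.2.2.1, h.2.2.1, h.2.2.2.2⟩⟩
  eq_or_eq_of_isLink_of_isLink := by
    rintro e x y v w ⟨h, -⟩ ⟨h', -⟩
    rcases Sym2.eq_iff.1 (h.symm.trans h') with h | h
    · exact Or.inl h.1
    · exact Or.inr h.1
  left_mem_of_isLink := fun _ _ _ h => h.2.2.1

/-- The degree of a vertex of a multigraph, loops being counted twice. -/
noncomputable def degree (G : Graph α β) (x : α) : ℕ∞ :=
  (G.incidenceSet x).encard + (G.loopSet x).encard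

/-- A path: distinct vertices `v 0, ..., v l` and distinct edges `e 0, ..., e (l - 1)`, and nothing
else, where `e i` joins `v i` and `v (i + 1)`. The trivial path (`l = 0`) is one vertex. -/
def IsPath (G : Graph α β) : Prop :=
  ∃ (l : ℕ) (v : Fin (l + 1) → α) (e : Fin l → β),
    Function.Injective v ∧ Function.Injective e ∧
    V(G) = Set.range v ∧ E(G) = Set.range e ∧
    ∀ i : Fin l, G.IsLink (e i) (v i.castSucc) (v i.succ)

/-- A cycle with `l + 1` vertices: distinct vertices `v 0, ..., v l` and distinct edges
`e 0, ..., e l`, and nothing else, where `e i` joins `v i` and `v (i + 1)`, indices being read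
modulo `l + 1`. A loop (`l = 0`) and two parallel edges (`l = 1`) are cycles. -/
def IsCycle (G : Graph α β) : Prop :=
  ∃ (l : ℕ) (v : Fin (l + 1) → α) (e : Fin (l + 1) → β),
    Function.Injective v ∧ Function.Injective e ∧
    V(G) = Set.range v ∧ E(G) = Set.range e ∧
    ∀ i : Fin (l + 1), G.IsLink (e i) (v i) (v (i + 1))

/-- `G` is the union of (vertex-)disjoint paths and cycles. -/
def IsUnionOfPathsAndCycles (G : Graph α β) : Prop :=
  ∃ S : Set (Graph α β),
    (∀ C ∈ S, C ≤ G ∧ (IsPath C ∨ IsCycle C)) ∧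
    (S.Pairwise fun C D => Disjoint V(C) V(D)) ∧
    V(G) = ⋃ C ∈ S, V(C) ∧ E(G) = ⋃ C ∈ S, E(C)

/-- `G` contains no cycle. -/
def IsCycleFree (G : Graph α β) : Prop := ∀ C : Graph α β, C ≤ G → ¬ IsCycle C

/-- `G` is connected: it has a vertex, and any two vertices are joined by a walk. -/
def IsConnected (G : Graph α β) : Prop :=
  V(G).Nonempty ∧ ∀ x ∈ V(G), ∀ y ∈ V(G), Relation.ReflTransGen G.Adj x y

/-- A decomposition of size `k` of `G`: spanning subgraphs `A 0, ..., A (k - 1)` whose edge sets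
partition the edge set of `G` (empty edge sets are allowed). -/
def IsDecomposition (G : Graph α β) {k : ℕ} (A : Fin k → Graph α β) : Prop :=
  (∀ i, A i ≤s G) ∧ E(G) = ⋃ i, E(A i) ∧ ∀ i j, i ≠ j → Disjoint E(A i) E(A j)

/-- A path decomposition: every colour class is a union of disjoint paths and cycles. -/
def IsPathDecomposition (G : Graph α β) {k : ℕ} (A : Fin k → Graph α β) : Prop :=
  IsDecomposition G A ∧ ∀ i, IsUnionOfPathsAndCycles (A i)

/-- A strong path decomposition: a path decomposition in which no colour class contains a
cycle. -/
def IsStrongPathDecomposition (G : Graph α β) {k : ℕ} (A : Fin k → Graph α β) : Prop :=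
  IsPathDecomposition G A ∧ ∀ i, IsCycleFree (A i)

/-- `F` is a 2-factor of `G`: a 2-regular spanning subgraph. -/
def IsTwoFactor (F G : Graph α β) : Prop := F ≤s G ∧ ∀ x ∈ V(F), degree F x = 2

/-- A 2-factorization: a decomposition into 2-factors. -/
def IsTwoFactorization (G : Graph α β) {k : ℕ} (F : Fin k → Graph α β) : Prop :=
  IsDecomposition G F ∧ ∀ i, IsTwoFactor (F i) G

/-- A Hamiltonian decomposition: a 2-factorization whose 2-factors are connected. -/
def IsHamiltonianDecomposition (G : Graph α β) {k : ℕ} (F : Fin k → Graph α β) : Prop :=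
  IsTwoFactorization G F ∧ ∀ i, IsConnected (F i)

/-- The decomposition `A` is enclosed in the decomposition `B` of the same size: each colour class
of `A` is a subgraph of the corresponding colour class of `B`. -/
def IsEnclosedIn {k : ℕ} (A B : Fin k → Graph α β) : Prop := ∀ i, A i ≤ B i

end Enclosing

namespace Enclosing

/-! Necessity is by restriction. Each of the `m` deleted vertices takes at most two edges from a
2-regular colour class, so at least `n - m` edges remain, and all degrees remain at most two. A
cycle left inside a Hamiltonian class would be a whole component of it, although it misses the
vertex `n`; so restricting a Hamiltonian class leaves no cycle.

For sufficiency the missing vertices are added one at a time. A colour class of maximal degree two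
is encoded by its matrix of multiplicities. If `m` vertices are still to come and `d i x` is the
number of edges of colour `i` that `x` lacks for degree two, then ideally the next vertex receives
`d i x / m` edges of colour `i` from `x`. These numbers sum to `μ` over the colours, to at most 2
over the vertices, and, if `m ≥ 2`, to at most 1 over a component of a colour class, since a
component lacks at most two edges. Rounding a circulation makes them integral and preserves these
bounds (`exists_balanced_rounding`, `exists_extension_degrees`).

The component bound prevents the new vertex from closing a cycle in a cycle-free class before the
last step. At the last step all degrees become two, and every closed nonempty vertex set of such a
class must contain the last vertex. So must its complement if nonempty; hence the class is connected
(`IsExtension.hasNoFullPart`, `IsExtension.eq_univ_of_isClosedPart`). -/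

/-! ### Rounding circulations and matrices. -/

/-- Double counting gives at most as many touched vertices as edges in `S`. The net-flow map from `S
→ ℚ` to functions on these vertices lands in the sum-zero hyperplane, so it is not onto, and by
dimension not injective. -/
theorem exists_kernel_of_fractional {V E : Type*} [Fintype E] [DecidableEq V]
    [DecidableEq E] (s t : E → V) (S : Finset E) (hS : S.Nonempty)
    (h2 : ∀ v, (∃ e ∈ S, t e = v ∨ s e = v) →
      2 ≤ (S.filter (t · = v)).card + (S.filter (s · = v)).card) :
    ∃ z : E → ℚ, z ≠ 0 ∧ (∀ e, e ∉ S → z e = 0) ∧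
      ∀ v, ∑ e, (if t e = v then z e else 0) = ∑ e, (if s e = v then z e else 0) := by
  classical
  let W : Finset V := S.image t ∪ S.image s
  have hWmem : ∀ v, v ∈ W ↔ ∃ e ∈ S, t e = v ∨ s e = v := by
    intro v
    simp only [W, Finset.mem_union, Finset.mem_image]
    grind
  have hcard : W.card ≤ S.card := by
    have h1 : ∑ v ∈ W, ((S.filter (t · = v)).card + (S.filter (s · = v)).card) =
        S.card + S.card := by
      rw [Finset.sum_add_distrib,
        ← Finset.card_eq_sum_card_fiberwise (f := t) (s := S) (t := W),
        ← Finset.card_eq_sum_card_fiberwise (f := s) (s := S) (t := W)]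
      · intro e he; exact (hWmem _).2 ⟨e, he, Or.inr rfl⟩
      · intro e he; exact (hWmem _).2 ⟨e, he, Or.inl rfl⟩
    have h3 : ∑ v ∈ W, 2 ≤ ∑ v ∈ W, ((S.filter (t · = v)).card + (S.filter (s · = v)).card) :=
      Finset.sum_le_sum fun v hv => h2 v ((hWmem v).1 hv)
    simp only [Finset.sum_const, smul_eq_mul] at h3
    omega
  let L : (S → ℚ) →ₗ[ℚ] (W → ℚ) :=
    { toFun := fun z v => ∑ e, ((if t e.1 = v.1 then z e else 0) - (if s e.1 = v.1 then z e else 0))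
      map_add' := by
        intro a b; ext v
        simp only [Pi.add_apply, ← Finset.sum_add_distrib]
        refine Finset.sum_congr rfl fun e _ => ?_
        split_ifs <;> ring
      map_smul' := by
        intro c a; ext v
        simp only [Pi.smul_apply, smul_eq_mul, RingHom.id_apply, Finset.mul_sum]
        refine Finset.sum_congr rfl fun e _ => ?_
        split_ifs <;> ring }
  have hsum : ∀ z, ∑ v, L z v = 0 := by
    intro z
    change ∑ v : W, ∑ e : S, _ = 0
    rw [Finset.sum_comm]
    refine Finset.sum_eq_zero fun e _ => ?_
    have a1 : ∀ w : W, ∑ v : W, (if w.1 = v.1 then z e else 0) = z e := by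
      intro w
      rw [Finset.sum_eq_single w, if_pos rfl]
      · intro v _ hv; exact if_neg fun h => hv (Subtype.ext h.symm)
      · simp
    rw [Finset.sum_sub_distrib, a1 ⟨t e.1, (hWmem _).2 ⟨e.1, e.2, Or.inl rfl⟩⟩,
      a1 ⟨s e.1, (hWmem _).2 ⟨e.1, e.2, Or.inr rfl⟩⟩, sub_self]
  have hinj : ¬ Function.Injective L := by
    intro hL
    have h1 := LinearMap.finrank_le_finrank_of_injective hL
    simp only [Module.finrank_fintype_fun_eq_card, Fintype.card_coe] at h1
    have h3 : Module.finrank ℚ (S → ℚ) = Module.finrank ℚ (W → ℚ) := by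
      simp only [Module.finrank_fintype_fun_eq_card, Fintype.card_coe]; omega
    have hsurj := (LinearMap.injective_iff_surjective_of_finrank_eq_finrank h3).1 hL
    obtain ⟨e, he⟩ := hS
    let w : W := ⟨t e, (hWmem _).2 ⟨e, he, Or.inl rfl⟩⟩
    obtain ⟨z, hz⟩ := hsurj (Pi.single w 1)
    have := hsum z
    rw [hz] at this
    simp at this
  rw [← LinearMap.ker_eq_bot, Submodule.eq_bot_iff] at hinj
  push Not at hinj
  obtain ⟨z, hz, hz0⟩ := hinj
  have hext : ∀ p : E → Prop, ∀ [DecidablePred p],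
      ∑ e, (if p e then (if h : e ∈ S then z ⟨e, h⟩ else 0) else 0) =
      ∑ e : S, (if p e.1 then z e else 0) := by
    intro p _
    rw [← Finset.sum_subset (Finset.subset_univ S), ← Finset.sum_coe_sort S]
    · simp
    · intro e _ he; simp [he]
  refine ⟨fun e => if h : e ∈ S then z ⟨e, h⟩ else 0, ?_, ?_, ?_⟩
  · intro h
    apply hz0
    ext e
    have := congrFun h e.1
    simpa using this
  · intro e he; simp [he]
  · intro v
    rw [hext (fun e => t e = v), hext (fun e => s e = v)]
    by_cases hv : v ∈ W
    · have := congrFun (LinearMap.mem_ker.1 hz) ⟨v, hv⟩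
      change ∑ e : S, _ = 0 at this
      rw [Finset.sum_sub_distrib] at this
      linarith
    · rw [Finset.sum_eq_zero, Finset.sum_eq_zero]
      · intro e _; rw [if_neg]; rintro rfl; exact hv ((hWmem _).2 ⟨e.1, e.2, Or.inr rfl⟩)
      · intro e _; rw [if_neg]; rintro rfl; exact hv ((hWmem _).2 ⟨e.1, e.2, Or.inl rfl⟩)

/-- If only one edge end at `v` carried a non-integral value, conservation at `v` would express that
value through integers. -/
theorem two_le_card_fractional {V E : Type*} [Fintype E] [DecidableEq V]
    [DecidableEq E] (s t : E → V) (f : E → ℚ)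
    (hf : ∀ v, ∑ e, (if t e = v then f e else 0) = ∑ e, (if s e = v then f e else 0))
    (v : V) (hv : ∃ e, Int.fract (f e) ≠ 0 ∧ (t e = v ∨ s e = v)) :
    2 ≤ ((Finset.univ.filter (fun e => Int.fract (f e) ≠ 0)).filter (t · = v)).card +
      ((Finset.univ.filter (fun e => Int.fract (f e) ≠ 0)).filter (s · = v)).card := by
  by_contra hlt
  obtain ⟨e, he, hev⟩ := hv
  have key : ∀ q : E → V, (∀ e', Int.fract (f e') ≠ 0 → q e' ≠ v) →
      ∃ c : ℤ, ∑ e, (if q e = v then f e else 0) = c := by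
    intro q hq
    refine ⟨∑ e, (if q e = v then ⌊f e⌋ else 0), ?_⟩
    push_cast
    refine Finset.sum_congr rfl fun e' _ => ?_
    split_ifs with h
    · by_contra hne
      refine hq e' (fun h0 => hne ?_) h
      have := Int.floor_add_fract (f e')
      linarith
    · rfl
  have key1 : ∀ q : E → V, q e = v → (∀ e', Int.fract (f e') ≠ 0 → q e' = v → e' = e) →
      ∃ c : ℤ, ∑ e, (if q e = v then f e else 0) = f e + c := by
    intro q hqe hq
    refine ⟨∑ e' ∈ Finset.univ.erase e, (if q e' = v then ⌊f e'⌋ else 0), ?_⟩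
    rw [← Finset.add_sum_erase _ _ (Finset.mem_univ e), if_pos hqe]
    push_cast
    congr 1
    refine Finset.sum_congr rfl fun e' he' => ?_
    split_ifs with h
    · by_contra hne
      refine Finset.ne_of_mem_erase he' (hq e' (fun h0 => hne ?_) h)
      have := Int.floor_add_fract (f e')
      linarith
    · rfl
  have fin : ∀ a b : E → V, ∑ e, (if a e = v then f e else 0) = ∑ e, (if b e = v then f e else 0) →
      a e = v → ((Finset.univ.filter (fun e => Int.fract (f e) ≠ 0)).filter (a · = v)).card +
      ((Finset.univ.filter (fun e => Int.fract (f e) ≠ 0)).filter (b · = v)).card < 2 → False := by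
    intro a b hab hae hlt
    have hpos : 0 < ((Finset.univ.filter (fun e => Int.fract (f e) ≠ 0)).filter (a · = v)).card :=
      Finset.card_pos.2 ⟨e, by simp [he, hae]⟩
    have h1 : ((Finset.univ.filter (fun e => Int.fract (f e) ≠ 0)).filter (a · = v)).card ≤ 1 := by
      omega
    have h0 : ((Finset.univ.filter (fun e => Int.fract (f e) ≠ 0)).filter (b · = v)).card = 0 := by
      omega
    rw [Finset.card_le_one] at h1
    rw [Finset.card_eq_zero, Finset.filter_eq_empty_iff] at h0
    obtain ⟨c, hc⟩ := key1 a hae (fun e' h h' => h1 e' (by simp [h, h']) e (by simp [he, hae]))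
    obtain ⟨d, hd⟩ := key b (fun e' h => h0 (by simpa using h))
    apply he
    have : f e = ((d - c : ℤ) : ℚ) := by push_cast; linarith
    rw [this, Int.fract_intCast]
  rcases hev with h | h
  · exact fin t s (hf v) h (by omega)
  · exact fin s t (hf v).symm h (by omega)

/-- A rational circulation can be rounded to an integral one, changing each value to its floor or
its ceiling. -/
theorem exists_integral_circulation {V E : Type*} [Fintype E] [DecidableEq V]
    [DecidableEq E] (s t : E → V) (f : E → ℚ)
    (hf : ∀ v, ∑ e, (if t e = v then f e else 0) = ∑ e, (if s e = v then f e else 0)) :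
    ∃ g : E → ℤ, (∀ v, ∑ e, (if t e = v then g e else 0) = ∑ e, (if s e = v then g e else 0)) ∧
      ∀ e, ⌊f e⌋ ≤ g e ∧ g e ≤ ⌈f e⌉ := by
  induction hc : (Finset.univ.filter (fun e => Int.fract (f e) ≠ 0)).card using
    Nat.strong_induction_on generalizing f with
  | _ c ih =>
  set S := Finset.univ.filter (fun e => Int.fract (f e) ≠ 0) with hSdef
  rcases S.eq_empty_or_nonempty with hS | hS
  · have h0 : ∀ e, (⌊f e⌋ : ℚ) = f e := by
      intro e
      have h : e ∉ S := by simp [hS]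
      simp only [hSdef, Finset.mem_filter, Finset.mem_univ, true_and, not_not] at h
      have := Int.floor_add_fract (f e)
      linarith
    refine ⟨fun e => ⌊f e⌋, fun v => ?_, fun e => ⟨le_rfl, Int.floor_le_ceil _⟩⟩
    have h1 : ∀ q : E → V, ((∑ e, (if q e = v then ⌊f e⌋ else 0) : ℤ) : ℚ) =
        ∑ e, (if q e = v then f e else 0) := by
      intro q
      push_cast
      simp only [h0]
    have := hf v
    rw [← h1, ← h1] at this
    exact_mod_cast this
  · obtain ⟨z, hz0, hzS, hz⟩ := exists_kernel_of_fractional s t S hS (by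
      intro v ⟨e, he, hev⟩
      exact two_le_card_fractional s t f hf v ⟨e, by simpa [hSdef] using he, hev⟩)
    obtain ⟨e₁, he₁⟩ := Function.ne_iff.1 hz0
    let T := Finset.univ.filter (fun e => z e ≠ 0)
    -- `τ e` is how far one can move along `z` before the value at `e` hits its ceiling or floor.
    -- The smallest such step keeps every value between its old floor and ceiling and makes `e₀`
    -- integral, so the number of fractional values drops.
    let τ : E → ℚ := fun e => if 0 < z e then (⌈f e⌉ - f e) / z e else (⌊f e⌋ - f e) / z e
    obtain ⟨e₀, he₀, hmin⟩ := T.exists_min_image τ ⟨e₁, by simpa [T] using he₁⟩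
    have he₀' : z e₀ ≠ 0 := by simpa [T] using he₀
    have hfl := fun e => Int.floor_le (f e)
    have hce := fun e => Int.le_ceil (f e)
    have hτ0 : 0 ≤ τ e₀ := by
      simp only [τ]
      split_ifs with h
      · exact div_nonneg (by linarith [hce e₀]) h.le
      · exact div_nonneg_of_nonpos (by linarith [hfl e₀]) (not_lt.1 h)
    have hb : ∀ e, (⌊f e⌋ : ℚ) ≤ f e + τ e₀ * z e ∧ f e + τ e₀ * z e ≤ ⌈f e⌉ := by
      intro e
      rcases lt_trichotomy (z e) 0 with h | h | h
      · have h1 := hmin e (by simp [T, h.ne])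
        have h3 : τ e = (⌊f e⌋ - f e) / z e := by simp [τ, not_lt.2 h.le]
        rw [h3, le_div_iff_of_neg h] at h1
        exact ⟨by linarith, by nlinarith [hce e]⟩
      · rw [h]; simpa using ⟨hfl e, hce e⟩
      · have h1 := hmin e (by simp [T, h.ne'])
        have h3 : τ e = (⌈f e⌉ - f e) / z e := by simp [τ, h]
        rw [h3, le_div_iff₀ h] at h1
        exact ⟨by nlinarith [hfl e], by linarith⟩
    have hint : Int.fract (f e₀ + τ e₀ * z e₀) = 0 := by
      simp only [τ]
      split_ifs with h
      · rw [div_mul_cancel₀ _ he₀']; simp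
      · rw [div_mul_cancel₀ _ he₀']; simp
    obtain ⟨g, hg, hgb⟩ := ih _ (by
      rw [← hc]
      refine Finset.card_lt_card (Finset.ssubset_iff_subset_ne.2 ⟨?_, ?_⟩)
      · intro e he
        by_contra heS
        have : z e = 0 := hzS e heS
        simp only [hSdef, Finset.mem_filter, Finset.mem_univ, true_and, not_not] at heS
        simp [this, heS] at he
      · intro heq
        have : e₀ ∈ S := by by_contra h; exact he₀' (hzS e₀ h)
        rw [← heq] at this
        simp [hint] at this) (fun e => f e + τ e₀ * z e) (by
      intro v
      have e1 : ∀ q : E → V, ∑ e, (if q e = v then f e + τ e₀ * z e else 0) =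
          ∑ e, (if q e = v then f e else 0) + τ e₀ * ∑ e, (if q e = v then z e else 0) := by
        intro q
        rw [Finset.mul_sum, ← Finset.sum_add_distrib]
        refine Finset.sum_congr rfl fun e _ => ?_
        split_ifs <;> simp
      rw [e1, e1, hf v, hz v]) rfl
    refine ⟨g, hg, fun e => ⟨?_, ?_⟩⟩
    · exact (Int.le_floor.2 (hb e).1).trans (hgb e).1
    · exact (hgb e).2.trans (Int.ceil_le.2 (hb e).2)

/-- The nodes of the network used in `exists_balanced_rounding`. -/
inductive RoundingNode (I X : Type*)
  | col (x : X)
  | block (i : I) (c : X)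
  | row (i : I)
  | base

/-- A rational matrix can be rounded so that all row sums, all column sums and all sums over the
blocks of partitions of the rows are rounded as well. -/
theorem exists_balanced_rounding {I X : Type*} [Fintype I] [Fintype X] [DecidableEq I]
    [DecidableEq X] (r : I → X → X) (f : I → X → ℚ) :
    ∃ g : I → X → ℤ, (∀ i x, ⌊f i x⌋ ≤ g i x ∧ g i x ≤ ⌈f i x⌉) ∧
      (∀ x, ⌊∑ i, f i x⌋ ≤ ∑ i, g i x ∧ ∑ i, g i x ≤ ⌈∑ i, f i x⌉) ∧
      (∀ i, ⌊∑ x, f i x⌋ ≤ ∑ x, g i x ∧ ∑ x, g i x ≤ ⌈∑ x, f i x⌉) ∧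
      (∀ i c, ∑ x, (if r i x = c then g i x else 0) ≤ ⌈∑ x, (if r i x = c then f i x else 0)⌉) := by
  classical
  -- The arcs run `col x → block i (r i x) → row i → base → col x`. They carry the entries, block
  -- sums, row sums and column sums, so rounding each arc rounds each of these sums.
  let s : (I × X) ⊕ (I × X) ⊕ I ⊕ X → RoundingNode I X :=
    Sum.elim (fun p => .col p.2) (Sum.elim (fun p => .block p.1 p.2)
      (Sum.elim (fun i => .row i) (fun _ => .base)))
  let t : (I × X) ⊕ (I × X) ⊕ I ⊕ X → RoundingNode I X :=
    Sum.elim (fun p => .block p.1 (r p.1 p.2)) (Sum.elim (fun p => .row p.1)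
      (Sum.elim (fun _ => .base) (fun x => .col x)))
  let F : (I × X) ⊕ (I × X) ⊕ I ⊕ X → ℚ := Sum.elim (fun p => f p.1 p.2)
    (Sum.elim (fun p => ∑ x, (if r p.1 x = p.2 then f p.1 x else 0))
    (Sum.elim (fun i => ∑ x, f i x) (fun x => ∑ i, f i x)))
  have hF : ∀ v, ∑ e, (if t e = v then F e else 0) = ∑ e, (if s e = v then F e else 0) := by
    rintro (x | ⟨i, c⟩ | i | u)
    · simp [s, t, F, Fintype.sum_prod_type]
    · simp [s, t, F, Fintype.sum_prod_type, ite_and, Finset.sum_ite_irrel]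
    · simp only [s, t, F, Fintype.sum_prod_type, Fintype.sum_sum_type]
      simp [Finset.sum_ite_irrel]
      rw [Finset.sum_comm]
      simp
    · simp only [s, t, F, Fintype.sum_prod_type, Fintype.sum_sum_type]
      simp
      exact Finset.sum_comm
  obtain ⟨G, hG, hGb⟩ := exists_integral_circulation s t F hF
  have h1 : ∀ x, G (Sum.inr (Sum.inr (Sum.inr x))) = ∑ i, G (Sum.inl (i, x)) := by
    intro x
    have := hG (.col x)
    simpa [s, t, Fintype.sum_prod_type] using this
  have h2 : ∀ i c, ∑ x, (if r i x = c then G (Sum.inl (i, x)) else 0) =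
      G (Sum.inr (Sum.inl (i, c))) := by
    intro i c
    have := hG (.block i c)
    simpa [s, t, Fintype.sum_prod_type, ite_and, Finset.sum_ite_irrel] using this
  have h3 : ∀ i, ∑ c, G (Sum.inr (Sum.inl (i, c))) = G (Sum.inr (Sum.inr (Sum.inl i))) := by
    intro i
    have := hG (.row i)
    simp only [s, t, Fintype.sum_prod_type, Fintype.sum_sum_type] at this
    simp [Finset.sum_ite_irrel] at this
    exact this
  have h4 : ∀ i, ∑ x, G (Sum.inl (i, x)) = G (Sum.inr (Sum.inr (Sum.inl i))) := by
    intro i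
    rw [← h3]
    simp only [← h2]
    rw [Finset.sum_comm]
    simp
  refine ⟨fun i x => G (Sum.inl (i, x)), fun i x => hGb (Sum.inl (i, x)), fun x => ?_,
    fun i => ?_, fun i c => ?_⟩
  · rw [← h1]; exact hGb (Sum.inr (Sum.inr (Sum.inr x)))
  · rw [h4]; exact hGb (Sum.inr (Sum.inr (Sum.inl i)))
  · rw [h2]; exact (hGb (Sum.inr (Sum.inl (i, c)))).2

/-! ### Components and one-vertex extensions of multiplicity matrices. -/

/-- A set of vertices that is closed under adjacency, for a multigraph given by its multiplicities. -/
def IsClosedPart {X : Type*} (M : X → X → ℕ) (U : Finset X) : Prop :=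
  ∀ x ∈ U, ∀ y, M x y ≠ 0 → y ∈ U

/-- Every nonempty closed set of vertices has a vertex of degree less than two. For multigraphs of
maximal degree two this says that there is no cycle. -/
def HasNoFullPart {X : Type*} [Fintype X] (M : X → X → ℕ) : Prop :=
  ∀ U : Finset X, U.Nonempty → IsClosedPart M U → ∃ x ∈ U, ∑ y, M x y < 2

/-- A canonical vertex in the connected component of a vertex. -/
noncomputable def componentRep {X : Type*} (M : X → X → ℕ) (x : X) : X :=
  Quotient.out (Quotient.mk (Relation.EqvGen.setoid fun a b => M a b ≠ 0) x)

theorem componentRep_eq_iff {X : Type*} {M : X → X → ℕ} {x y : X} :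
    componentRep M x = componentRep M y ↔ Relation.EqvGen (fun a b => M a b ≠ 0) x y := by
  unfold componentRep
  rw [Quotient.out_inj, Quotient.eq]
  rfl

theorem IsClosedPart.mem_of_eqvGen {X : Type*} {M : X → X → ℕ} {U : Finset X}
    (hU : IsClosedPart M U) (hs : ∀ x y, M x y = M y x) {x y : X}
    (h : Relation.EqvGen (fun a b => M a b ≠ 0) x y) : x ∈ U ↔ y ∈ U := by
  induction h with
  | rel a b hab => exact ⟨fun h => hU a h b hab, fun h => hU b h a (by rwa [hs])⟩
  | refl a => rfl
  | symm a b _ ih => exact ih.symm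
  | trans a b c _ _ ih1 ih2 => exact ih1.trans ih2

theorem even_sum_sum {X : Type*} [DecidableEq X] {M : X → X → ℕ} (hs : ∀ x y, M x y = M y x)
    (h0 : ∀ x, M x x = 0) (U : Finset X) : Even (∑ x ∈ U, ∑ y ∈ U, M x y) := by
  induction U using Finset.induction_on with
  | empty => simp
  | insert a U ha ih =>
    rw [Finset.sum_insert ha, Finset.sum_insert ha, h0, zero_add]
    have : ∑ x ∈ U, ∑ y ∈ insert a U, M x y = ∑ x ∈ U, M a x + ∑ x ∈ U, ∑ y ∈ U, M x y := by
      rw [← Finset.sum_add_distrib]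
      exact Finset.sum_congr rfl fun x _ => by rw [Finset.sum_insert ha, hs x a]
    rw [this, ← add_assoc]
    exact Even.add ⟨_, rfl⟩ ih

theorem IsClosedPart.sum_eq {X : Type*} [Fintype X] {M : X → X → ℕ} {U : Finset X}
    (hU : IsClosedPart M U) {x : X} (hx : x ∈ U) : ∑ y, M x y = ∑ y ∈ U, M x y := by
  symm
  refine Finset.sum_subset (Finset.subset_univ U) fun y _ hy => ?_
  by_contra h
  exact hy (hU x hx y h)

theorem isClosedPart_component {X : Type*} [Fintype X] [DecidableEq X] {M : X → X → ℕ} (c : X) :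
    IsClosedPart M (Finset.univ.filter (componentRep M · = c)) := by
  intro x hx y hxy
  simp only [Finset.mem_filter, Finset.mem_univ, true_and] at hx ⊢
  rw [← hx, componentRep_eq_iff]
  exact (Relation.EqvGen.rel x y hxy).symm

/-- A connected multigraph with `c` vertices has at least `c - 1` edges. -/
theorem card_component_le {X : Type*} [Fintype X] [DecidableEq X] {M : X → X → ℕ}
    (hs : ∀ x y, M x y = M y x) (h0 : ∀ x, M x x = 0) (c : X) :
    2 * (Finset.univ.filter (componentRep M · = c)).card ≤
      ∑ x ∈ Finset.univ.filter (componentRep M · = c), ∑ y, M x y + 2 := by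
  set C := Finset.univ.filter (componentRep M · = c) with hC
  rcases C.eq_empty_or_nonempty with h | ⟨a, ha⟩
  · simp [h]
  -- A set is grown from `a` inside the component; each vertex added brings at least one edge to the
  -- earlier ones, which adds 2 to the degree sum.
  have key : ∀ j, j + 1 ≤ C.card → ∃ T ⊆ C, a ∈ T ∧ T.card = j + 1 ∧
      2 * T.card ≤ ∑ x ∈ T, ∑ y ∈ T, M x y + 2 := by
    intro j
    induction j with
    | zero => exact fun _ => ⟨{a}, by simpa using ha, by simp, by simp, by simp⟩
    | succ j ih =>
      intro hj
      obtain ⟨T, hT, haT, hcard, hle⟩ := ih (by omega)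
      obtain ⟨x, hx, y, hy, hxy⟩ : ∃ x ∈ T, ∃ y, y ∉ T ∧ M x y ≠ 0 := by
        by_contra hcon
        push Not at hcon
        have hcl : IsClosedPart M T := by
          intro x hx y hxy
          by_contra hy
          exact hxy (hcon x hx y hy)
        have : C ⊆ T := by
          intro b hb
          refine (hcl.mem_of_eqvGen hs (x := a) ?_).1 haT
          rw [← componentRep_eq_iff]
          simp only [hC, Finset.mem_filter, Finset.mem_univ, true_and] at ha hb
          rw [ha, hb]
        have := Finset.card_le_card this
        omega
      refine ⟨insert y T, ?_, Finset.mem_insert_of_mem haT, ?_, ?_⟩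
      · exact Finset.insert_subset (isClosedPart_component c x (hT hx) y hxy) hT
      · rw [Finset.card_insert_of_notMem hy, hcard]
      · rw [Finset.card_insert_of_notMem hy, Finset.sum_insert hy, Finset.sum_insert hy, h0]
        have h1 : ∑ x ∈ T, ∑ z ∈ insert y T, M x z =
            ∑ x ∈ T, M y x + ∑ x ∈ T, ∑ z ∈ T, M x z := by
          rw [← Finset.sum_add_distrib]
          exact Finset.sum_congr rfl fun x _ => by rw [Finset.sum_insert hy, hs x y]
        have h2 : M y x ≤ ∑ x ∈ T, M y x := Finset.single_le_sum (by simp) hx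
        rw [hs] at hxy
        omega
  have hpos : 0 < C.card := Finset.card_pos.2 ⟨a, ha⟩
  obtain ⟨T, hT, -, hcard, hle⟩ := key (C.card - 1) (by omega)
  rw [Finset.eq_of_subset_of_card_le hT (by omega)] at hle
  have : ∑ x ∈ C, ∑ y, M x y = ∑ x ∈ C, ∑ y ∈ C, M x y :=
    Finset.sum_congr rfl fun x hx => (isClosedPart_component (M := M) c).sum_eq hx
  omega

/-- `M'` is the multigraph obtained from `M` by adding one vertex, joined to `x` by `g x` edges. -/
structure IsExtension {n : ℕ} (M : Fin n → Fin n → ℕ) (g : Fin n → ℕ)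
    (M' : Fin (n + 1) → Fin (n + 1) → ℕ) : Prop where
  old : ∀ x y : Fin n, M' x.castSucc y.castSucc = M x y
  new_right : ∀ x : Fin n, M' x.castSucc (Fin.last n) = g x
  new_left : ∀ x : Fin n, M' (Fin.last n) x.castSucc = g x
  diag : M' (Fin.last n) (Fin.last n) = 0

namespace IsExtension
variable {n : ℕ} {M : Fin n → Fin n → ℕ} {g : Fin n → ℕ} {M' : Fin (n + 1) → Fin (n + 1) → ℕ}

theorem sum_castSucc (h : IsExtension M g M') (x : Fin n) :
    ∑ y, M' x.castSucc y = ∑ y, M x y + g x := by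
  simp [Fin.sum_univ_castSucc, h.old, h.new_right]

theorem sum_last (h : IsExtension M g M') : ∑ y, M' (Fin.last n) y = ∑ y, g y := by
  simp [Fin.sum_univ_castSucc, h.new_left, h.diag]

theorem isClosedPart (h : IsExtension M g M') {U : Finset (Fin (n + 1))} (hU : IsClosedPart M' U) :
    IsClosedPart M (Finset.univ.filter (·.castSucc ∈ U)) := by
  intro x hx y hxy
  simp only [Finset.mem_filter, Finset.mem_univ, true_and] at hx ⊢
  exact hU _ hx _ (by rwa [h.old])

/-- A closed set avoiding the new vertex gains no edges, so it would already be closed and full in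
`M`. -/
theorem last_mem (h : IsExtension M g M') (hM : HasNoFullPart M) {U : Finset (Fin (n + 1))}
    (hne : U.Nonempty) (hU : IsClosedPart M' U) (hdeg : ∀ x ∈ U, 2 ≤ ∑ y, M' x y) :
    Fin.last n ∈ U := by
  by_contra hlast
  obtain ⟨x, hx, hlt⟩ := hM _ (by
    obtain ⟨x, hx⟩ := hne
    rcases Fin.eq_castSucc_or_eq_last x with ⟨y, rfl⟩ | rfl
    · exact ⟨y, by simpa using hx⟩
    · exact absurd hx hlast) (h.isClosedPart hU)
  simp only [Finset.mem_filter, Finset.mem_univ, true_and] at hx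
  have h1 := hdeg _ hx
  rw [h.sum_castSucc] at h1
  apply hlast
  refine hU _ hx _ ?_
  rw [h.new_right]
  omega

/-- A full closed set contains the new vertex, hence a neighbour and its whole old component `C`.
The degree sum of `C` in `M` is below `2 * C.card` and even, so at least 2 is lacking, but the new
vertex supplies at most 1. -/
theorem hasNoFullPart (h : IsExtension M g M') (hs : ∀ x y, M x y = M y x) (h0 : ∀ x, M x x = 0)
    (hM : HasNoFullPart M) (hdeg : ∀ x, ∑ y, M x y ≤ 2)
    (hg : ∀ c, ∑ x, (if componentRep M x = c then g x else 0) ≤ 1) : HasNoFullPart M' := by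
  intro U hne hU
  by_contra hcon
  push Not at hcon
  have hlast := h.last_mem hM hne hU hcon
  have h2 := hcon _ hlast
  rw [h.sum_last] at h2
  obtain ⟨x, -, hx⟩ := Finset.exists_ne_zero_of_sum_ne_zero (s := Finset.univ) (f := g) (by omega)
  have hxU : x.castSucc ∈ U := hU _ hlast _ (by rwa [h.new_left])
  set C := Finset.univ.filter (componentRep M · = componentRep M x) with hC
  have hcl : IsClosedPart M C := isClosedPart_component _
  have hCU : ∀ y ∈ C, y.castSucc ∈ U := by
    intro y hy
    simp only [hC, Finset.mem_filter, Finset.mem_univ, true_and] at hy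
    have := ((h.isClosedPart hU).mem_of_eqvGen hs (componentRep_eq_iff.1 hy)).2 (by simpa using hxU)
    simpa using this
  obtain ⟨y, hy, hylt⟩ := hM C ⟨x, by simp [hC]⟩ hcl
  have h3 : ∑ x ∈ C, ∑ y, M x y < ∑ x ∈ C, 2 :=
    Finset.sum_lt_sum (fun x _ => hdeg x) ⟨y, hy, hylt⟩
  have h4 : ∑ x ∈ C, 2 ≤ ∑ x ∈ C, (∑ y, M x y + g x) :=
    Finset.sum_le_sum fun x hx => by rw [← h.sum_castSucc]; exact hcon _ (hCU x hx)
  have h5 := hg (componentRep M x)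
  rw [← Finset.sum_filter, ← hC] at h5
  have h6 := even_sum_sum hs h0 C
  rw [← Finset.sum_congr rfl (fun x hx => hcl.sum_eq hx)] at h6
  rw [Finset.sum_add_distrib] at h4
  simp only [Finset.sum_const, smul_eq_mul] at h3 h4
  obtain ⟨a, ha⟩ := h6
  omega

/-- By symmetry the complement of a closed set is closed; if both were nonempty, both would contain
the new vertex. -/
theorem eq_univ_of_isClosedPart (h : IsExtension M g M') (hs : ∀ x y, M' x y = M' y x)
    (hM : HasNoFullPart M) (hdeg : ∀ x, 2 ≤ ∑ y, M' x y) {U : Finset (Fin (n + 1))}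
    (hne : U.Nonempty) (hU : IsClosedPart M' U) : U = Finset.univ := by
  by_contra hcon
  have h1 := h.last_mem hM hne hU fun x _ => hdeg x
  have h2 := h.last_mem hM (U := Uᶜ) (by
    rw [Finset.nonempty_iff_ne_empty]; simpa using hcon) (by
    intro x hx y hxy
    simp only [Finset.mem_compl] at hx ⊢
    exact fun hy => hx (hU y hy x (by rwa [hs]))) fun x _ => hdeg x
  simp only [Finset.mem_compl] at h2
  exact h2 h1

end IsExtension

/-! ### Degrees at the new vertex. -/

/-- The deficiencies `d i x` are spread evenly over the `m` vertices still to come, and the shares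
`d i x / m` are rounded. The conclusions are the hypotheses needed for the next step with `n + 1`
and `m - 1`. -/
theorem exists_extension_degrees {n m μ k : ℕ} (M : Fin k → Fin n → Fin n → ℕ)
    (hs : ∀ i x y, M i x y = M i y x) (h0 : ∀ i x, M i x x = 0)
    (hμ : ∀ x y, x ≠ y → ∑ i, M i x y = μ) (hm : 1 ≤ m) (hk : 2 * k + μ = μ * (n + m))
    (hdeg : ∀ i x, ∑ y, M i x y ≤ 2) (hsum : ∀ i, 2 * n ≤ ∑ x, ∑ y, M i x y + 2 * m) :
    ∃ g : Fin k → Fin n → ℕ, (∀ x, ∑ i, g i x = μ) ∧ (∀ i x, ∑ y, M i x y + g i x ≤ 2) ∧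
      (∀ i, ∑ x, g i x ≤ 2) ∧
      (∀ i, 2 * (n + 1) ≤ ∑ x, ∑ y, M i x y + 2 * ∑ x, g i x + 2 * (m - 1)) ∧
      (2 ≤ m → ∀ i c, ∑ x, (if componentRep (M i) x = c then g i x else 0) ≤ 1) := by
  have hm0 : (0 : ℚ) < m := by exact_mod_cast hm
  let d : Fin k → Fin n → ℤ := fun i x => 2 - ∑ y, (M i x y : ℤ)
  have hd0 : ∀ i x, 0 ≤ d i x := by
    intro i x
    have : (∑ y, (M i x y : ℤ)) ≤ 2 := by exact_mod_cast hdeg i x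
    simp only [d]; omega
  have hd2 : ∀ i x, d i x ≤ 2 := by
    intro i x
    have : 0 ≤ (∑ y, (M i x y : ℤ)) := Finset.sum_nonneg fun _ _ => by positivity
    simp only [d]; omega
  -- This is where the size condition enters: `2 * k - μ * (n - 1) = μ * m`.
  have hcol : ∀ x, ∑ i, d i x = μ * m := by
    intro x
    have h1 : ∑ i, ∑ y, (M i x y : ℤ) = μ * n - μ := by
      rw [Finset.sum_comm, ← Finset.add_sum_erase _ _ (Finset.mem_univ x)]
      have : ∑ y ∈ Finset.univ.erase x, ∑ i, (M i x y : ℤ) = ∑ y ∈ Finset.univ.erase x, (μ : ℤ) :=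
        Finset.sum_congr rfl fun y hy => by exact_mod_cast hμ x y (Finset.ne_of_mem_erase hy).symm
      rw [this]
      have hn : 1 ≤ n := x.pos
      simp [h0, Finset.card_erase_of_mem, Nat.cast_sub hn]
      ring
    simp only [d, Finset.sum_sub_distrib, h1]
    simp
    have : (2 * k + μ : ℤ) = μ * (n + m) := by exact_mod_cast hk
    linarith
  let D : Fin k → ℤ := fun i => ∑ x, d i x
  have hDM : ∀ i, D i + ((∑ x, ∑ y, M i x y : ℕ) : ℤ) = 2 * n := by
    intro i
    simp only [D, d, Finset.sum_sub_distrib]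
    push_cast
    simp
    ring
  have hDm : ∀ i, D i ≤ 2 * m := by
    intro i
    have h1 := hDM i
    have h2 := hsum i
    omega
  have hD0 : ∀ i, 0 ≤ D i := fun i => Finset.sum_nonneg fun x _ => hd0 i x
  have hDeven : ∀ i, ∃ a, D i = 2 * a := by
    intro i
    obtain ⟨a, ha⟩ := even_sum_sum (hs i) (h0 i) Finset.univ
    exact ⟨n - a, by have := hDM i; omega⟩
  -- For `m = 1` the total deficiency is `2 * k` and each colour has at most 2, so equality holds
  -- throughout.
  have hD1 : m = 1 → ∀ i, D i = 2 := by
    intro h1 i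
    have ht : ∑ i, D i = ∑ i : Fin k, (2 : ℤ) := by
      have : ∑ i, D i = ∑ x, ∑ i, d i x := Finset.sum_comm
      rw [this]
      simp only [hcol]
      subst h1
      simp
      have : (2 * k + μ : ℤ) = μ * (n + 1) := by exact_mod_cast hk
      linarith
    exact (Finset.sum_eq_sum_iff_of_le (fun i _ => by have := hDm i; subst h1; omega)).1 ht i
      (Finset.mem_univ i)
  obtain ⟨G, hG, hGcol, hGrow, hGc⟩ := exists_balanced_rounding (fun i => componentRep (M i))
    (fun i x => (d i x : ℚ) / m)
  have hG0 : ∀ i x, 0 ≤ G i x := fun i x =>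
    (Int.floor_nonneg.2 (div_nonneg (by exact_mod_cast hd0 i x) hm0.le)).trans (hG i x).1
  have hcast : ∀ i x, (((G i x).toNat : ℕ) : ℤ) = G i x := fun i x => Int.toNat_of_nonneg (hG0 i x)
  have hrow : ∀ i, ∑ x, (d i x : ℚ) / m = D i / m := by
    intro i
    rw [← Finset.sum_div]
    simp [D]
  have hup : ∀ i, ∑ x, G i x ≤ 2 := by
    intro i
    refine (hGrow i).2.trans (Int.ceil_le.2 ?_)
    rw [hrow, div_le_iff₀ hm0]
    exact_mod_cast hDm i
  have hlow : ∀ i (z : ℤ), z * m ≤ D i → z ≤ ∑ x, G i x := by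
    intro i z hz
    refine le_trans (Int.le_floor.2 ?_) (hGrow i).1
    rw [hrow, le_div_iff₀ hm0]
    exact_mod_cast hz
  refine ⟨fun i x => (G i x).toNat, fun x => ?_, fun i x => ?_, fun i => ?_, fun i => ?_,
    fun h2 i c => ?_⟩
  · have h1 : ∑ i, (d i x : ℚ) / m = (μ : ℤ) := by
      rw [← Finset.sum_div, div_eq_iff hm0.ne']
      exact_mod_cast hcol x
    have := hGcol x
    rw [h1, Int.floor_intCast, Int.ceil_intCast] at this
    zify
    simp only [hcast]
    omega
  · have h1 : G i x ≤ d i x := by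
      refine (hG i x).2.trans (Int.ceil_le.2 ?_)
      rw [div_le_iff₀ hm0]
      have h3 : (0 : ℚ) ≤ d i x := by exact_mod_cast hd0 i x
      have h4 : (1 : ℚ) ≤ m := by exact_mod_cast hm
      nlinarith
    zify
    rw [hcast]
    simp only [d] at h1
    omega
  · zify
    simp only [hcast]
    exact hup i
  · have h1 := hDM i
    have h3 := hDm i
    have h4 := hD0 i
    -- With `D i = 2 * a`, the target is `∑ x, g i x ≥ a + 2 - m`, where `a ≤ m`. The floor of `D i
    -- / m` gives 2 for `a = m`, and at least 1 for `a = m - 1` when `m ≥ 2`; smaller `a` needs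
    -- nothing. Parity excludes other values of `D i`, and `h8` covers `m = 1`.
    have h5 := hlow i 2
    have h6 := hlow i 1
    have h7 := hlow i 0
    obtain ⟨a, ha⟩ := hDeven i
    zify [hm]
    simp only [hcast]
    push_cast at h1
    have h8 : m = 1 → D i = 2 := fun h => hD1 h i
    omega
  · zify
    simp only [hcast]
    refine (hGc i c).trans (Int.ceil_le.2 ?_)
    have h3 : ∑ x, (if componentRep (M i) x = c then (d i x : ℚ) / m else 0) =
        (∑ x ∈ Finset.univ.filter (componentRep (M i) · = c), (d i x : ℚ)) / m := by
      rw [← Finset.sum_filter, Finset.sum_div]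
    rw [h3, div_le_iff₀ hm0]
    -- A connected part with `c` vertices has degree sum at least `2c - 2`; dividing its deficiency
    -- by `m ≥ 2` leaves at most 1.
    have h4 : ∑ x ∈ Finset.univ.filter (componentRep (M i) · = c), d i x ≤ 2 := by
      have := card_component_le (hs i) (h0 i) c
      zify at this
      simp only [d, Finset.sum_sub_distrib]
      simp
      linarith
    have h5 : (∑ x ∈ Finset.univ.filter (componentRep (M i) · = c), (d i x : ℚ)) ≤ 2 := by
      exact_mod_cast h4
    have h6 : (2 : ℚ) ≤ m := by exact_mod_cast h2
    push_cast
    linarith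

/-! ### Edge colourings and their extension. -/

/-- The number of edges of colour `i` between `x` and `y`, for a colouring of `μ K_N`. -/
def multiplicity {k : ℕ} (μ : ℕ) (col : Sym2 ℕ × ℕ → Fin k) (i : Fin k) (x y : ℕ) : ℕ :=
  if x = y then 0 else ((Finset.range μ).filter (fun j => col (s(x, y), j) = i)).card

theorem multiplicity_comm {k μ : ℕ} (col : Sym2 ℕ × ℕ → Fin k) (i : Fin k) (x y : ℕ) :
    multiplicity μ col i x y = multiplicity μ col i y x := by
  simp only [multiplicity, eq_comm (a := x), Sym2.eq_swap (a := x)]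

theorem multiplicity_self {k μ : ℕ} (col : Sym2 ℕ × ℕ → Fin k) (i : Fin k) (x : ℕ) :
    multiplicity μ col i x x = 0 := by simp [multiplicity]

theorem sum_multiplicity {k μ : ℕ} (col : Sym2 ℕ × ℕ → Fin k) {x y : ℕ} (h : x ≠ y) :
    ∑ i, multiplicity μ col i x y = μ := by
  simp only [multiplicity, if_neg h]
  rw [← Finset.card_eq_sum_card_fiberwise (fun _ _ => Finset.mem_coe.2 (Finset.mem_univ _)),
    Finset.card_range]

/-- The multiplicities of the edges of colour `i` between the vertices `0, ..., n - 1`. -/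
def colourMatrix {k : ℕ} (μ n : ℕ) (col : Sym2 ℕ × ℕ → Fin k) (i : Fin k) (x y : Fin n) : ℕ :=
  multiplicity μ col i x y

/-- A connected multigraph: no nonempty proper set of vertices is closed under adjacency. -/
def IsConnectedMatrix {X : Type*} [Fintype X] (M : X → X → ℕ) : Prop :=
  ∀ U : Finset X, U.Nonempty → IsClosedPart M U → U = Finset.univ

theorem colourMatrix_comm {k μ n : ℕ} (col : Sym2 ℕ × ℕ → Fin k) (i : Fin k) (x y : Fin n) :
    colourMatrix μ n col i x y = colourMatrix μ n col i y x := multiplicity_comm _ _ _ _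

theorem colourMatrix_self {k μ n : ℕ} (col : Sym2 ℕ × ℕ → Fin k) (i : Fin k) (x : Fin n) :
    colourMatrix μ n col i x x = 0 := multiplicity_self _ _ _

theorem sum_colourMatrix {k μ n : ℕ} (col : Sym2 ℕ × ℕ → Fin k) {x y : Fin n} (h : x ≠ y) :
    ∑ i, colourMatrix μ n col i x y = μ :=
  sum_multiplicity _ fun h' => h (Fin.ext h')

theorem sum_sum_colourMatrix {k μ n : ℕ} (col : Sym2 ℕ × ℕ → Fin k) (x : Fin n) :
    ∑ i, ∑ y, colourMatrix μ n col i x y + μ = μ * n := by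
  rw [Finset.sum_comm, ← Finset.add_sum_erase _ _ (Finset.mem_univ x)]
  rw [Finset.sum_congr rfl fun y hy => sum_colourMatrix col (Finset.ne_of_mem_erase hy).symm]
  obtain ⟨n, rfl⟩ := Nat.exists_eq_succ_of_ne_zero x.pos.ne'
  simp [colourMatrix_self]
  ring

theorem colourMatrix_congr {k μ n : ℕ} {col col' : Sym2 ℕ × ℕ → Fin k}
    (h : ∀ x y j, x < n → y < n → col' (s(x, y), j) = col (s(x, y), j)) (i : Fin k) :
    colourMatrix μ n col' i = colourMatrix μ n col i := by
  ext x y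
  simp only [colourMatrix, multiplicity, h x y _ x.2 y.2]

theorem exists_colour_sequence {k μ : ℕ} (hk : 0 < k) (h : Fin k → ℕ) (hsum : ∑ i, h i = μ) :
    ∃ c : ℕ → Fin k, ∀ i, ((Finset.range μ).filter (fun j => c j = i)).card = h i := by
  have e : Fin μ ≃ Σ i, Fin (h i) := Fintype.equivOfCardEq (by simp [hsum])
  -- Labels `j ≥ μ` belong to no edge, so their colour is arbitrary.
  refine ⟨fun j => if hj : j < μ then (e ⟨j, hj⟩).1 else ⟨0, hk⟩, fun i => ?_⟩
  have h1 : (Finset.univ.filter (fun p : Σ i, Fin (h i) => p.1 = i)).card = h i := by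
    rw [← Fintype.card_subtype, Fintype.card_congr (Equiv.sigmaSubtype i), Fintype.card_fin]
  rw [← h1]
  refine Finset.card_bij (fun j hj => e ⟨j, by simp at hj; exact hj.1⟩) ?_ ?_ ?_
  · intro j hj
    simp only [Finset.mem_filter, Finset.mem_range, Finset.mem_univ, true_and] at hj ⊢
    simpa [hj.1] using hj.2
  · intro a ha b hb hab
    simpa using hab
  · intro p hp
    simp only [Finset.mem_filter, Finset.mem_univ, true_and] at hp
    exact ⟨e.symm p, by simpa using hp, by simp⟩

theorem isExtension_colourMatrix {k μ n : ℕ} {col col' : Sym2 ℕ × ℕ → Fin k}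
    {c : Fin n → ℕ → Fin k} {g : Fin k → Fin n → ℕ}
    (hc : ∀ x i, ((Finset.range μ).filter (fun j => c x j = i)).card = g i x)
    (hold : ∀ x y j, x < n → y < n → col' (s(x, y), j) = col (s(x, y), j))
    (hnew : ∀ (x : Fin n) j, col' (s(x.1, n), j) = c x j) (i : Fin k) :
    IsExtension (colourMatrix μ n col i) (g i) (colourMatrix μ (n + 1) col' i) where
  old x y := by simp [colourMatrix, multiplicity, hold x y _ x.2 y.2]
  new_right x := by simp [colourMatrix, multiplicity, hnew, hc, x.2.ne]
  new_left x := by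
    rw [colourMatrix_comm]
    simp [colourMatrix, multiplicity, hnew, hc, x.2.ne]
  diag := colourMatrix_self _ _ _

/-- Extension of a colouring by one vertex. -/
theorem exists_colouring_succ {k μ n m : ℕ} (col : Sym2 ℕ × ℕ → Fin k) (hm : 1 ≤ m)
    (hk : 2 * k + μ = μ * (n + m))
    (hdeg : ∀ i x, ∑ y, colourMatrix μ n col i x y ≤ 2)
    (hsum : ∀ i, 2 * n ≤ ∑ x, ∑ y, colourMatrix μ n col i x y + 2 * m) :
    ∃ col' : Sym2 ℕ × ℕ → Fin k,
      (∀ x y j, x < n → y < n → col' (s(x, y), j) = col (s(x, y), j)) ∧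
      (∀ i x, ∑ y, colourMatrix μ (n + 1) col' i x y ≤ 2) ∧
      (∀ i, 2 * (n + 1) ≤ ∑ x, ∑ y, colourMatrix μ (n + 1) col' i x y + 2 * (m - 1)) ∧
      (2 ≤ m → ∀ i, HasNoFullPart (colourMatrix μ n col i) →
        HasNoFullPart (colourMatrix μ (n + 1) col' i)) ∧
      (m = 1 → ∀ i, HasNoFullPart (colourMatrix μ n col i) →
        IsConnectedMatrix (colourMatrix μ (n + 1) col' i)) := by
  have hk0 : 0 < k := (col (s(0, 0), 0)).pos
  obtain ⟨g, hg1, hg2, hg3, hg4, hg5⟩ := exists_extension_degrees (colourMatrix μ n col)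
    (colourMatrix_comm col) (colourMatrix_self col) (fun x y h => sum_colourMatrix col h) hm hk hdeg
    hsum
  choose c hc using fun x => exists_colour_sequence hk0 (fun i => g i x) (hg1 x)
  -- Only edges joining the new vertex `n` to a smaller vertex are recoloured.
  let col' : Sym2 ℕ × ℕ → Fin k := fun e =>
    if h : e.1.sup = n ∧ e.1.inf < n then c ⟨e.1.inf, h.2⟩ e.2 else col e
  have hold : ∀ x y j, x < n → y < n → col' (s(x, y), j) = col (s(x, y), j) := by
    intro x y j hx hy
    have : ¬ (x ⊔ y = n ∧ x ⊓ y < n) := by rintro ⟨h, -⟩; omega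
    exact dif_neg this
  have hnew : ∀ (x : Fin n) j, col' (s(x.1, n), j) = c x j := by
    intro x j
    have h1 : x.1 ⊔ n = n ∧ x.1 ⊓ n < n := by have := x.2; omega
    refine (dif_pos h1).trans ?_
    exact congrArg (c · j) (Fin.ext (by have := x.2; simp))
  have hext := isExtension_colourMatrix hc hold hnew
  have hdeg' : ∀ i x, ∑ y, colourMatrix μ (n + 1) col' i x y ≤ 2 := by
    intro i x
    rcases Fin.eq_castSucc_or_eq_last x with ⟨y, rfl⟩ | rfl
    · rw [(hext i).sum_castSucc]; exact hg2 i y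
    · rw [(hext i).sum_last]; exact hg3 i
  have hsum' : ∀ i, 2 * (n + 1) ≤
      ∑ x, ∑ y, colourMatrix μ (n + 1) col' i x y + 2 * (m - 1) := by
    intro i
    rw [Fin.sum_univ_castSucc, (hext i).sum_last]
    simp only [(hext i).sum_castSucc, Finset.sum_add_distrib]
    have := hg4 i
    omega
  refine ⟨col', hold, hdeg', hsum', fun h2 i hi => ?_, fun h1 i hi => ?_⟩
  · exact (hext i).hasNoFullPart (colourMatrix_comm col i) (colourMatrix_self col i) hi (hdeg i)
      (hg5 h2 i)
  · intro U hne hU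
    refine (hext i).eq_univ_of_isClosedPart (colourMatrix_comm col' i) hi (fun x => ?_) hne hU
    -- For `m = 1` the lower bound on the degree sum meets the upper bound 2 at each vertex.
    have e : ∑ x, ∑ y, colourMatrix μ (n + 1) col' i x y = ∑ x : Fin (n + 1), 2 := by
      refine le_antisymm (Finset.sum_le_sum fun x _ => hdeg' i x) ?_
      have := hsum' i
      simp
      omega
    exact ((Finset.sum_eq_sum_iff_of_le fun x _ => hdeg' i x).1 e x (Finset.mem_univ x)).ge

/-- Extension of a colouring of `μ K_n` to a 2-factorization of `μ K_N`. -/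
theorem exists_colouring_add {k μ N : ℕ} (hk : 2 * k + μ = μ * N) (m : ℕ) :
    ∀ (n : ℕ) (col : Sym2 ℕ × ℕ → Fin k), n + m = N →
    (∀ i x, ∑ y, colourMatrix μ n col i x y ≤ 2) →
    (∀ i, 2 * n ≤ ∑ x, ∑ y, colourMatrix μ n col i x y + 2 * m) →
    ∃ col' : Sym2 ℕ × ℕ → Fin k,
      (∀ x y j, x < n → y < n → col' (s(x, y), j) = col (s(x, y), j)) ∧
      (∀ i x, ∑ y, colourMatrix μ N col' i x y = 2) ∧
      (1 ≤ m → ∀ i, HasNoFullPart (colourMatrix μ n col i) →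
        IsConnectedMatrix (colourMatrix μ N col' i)) := by
  induction m with
  | zero =>
    rintro n col rfl hdeg hsum
    refine ⟨col, fun _ _ _ _ _ => rfl, fun i x => ?_, by simp⟩
    refine (Finset.sum_eq_sum_iff_of_le fun x _ => hdeg i x).1 ?_ x (Finset.mem_univ x)
    refine le_antisymm (Finset.sum_le_sum fun x _ => hdeg i x) ?_
    have := hsum i
    simp
    omega
  | succ m ih =>
    rintro n col rfl hdeg hsum
    obtain ⟨col₁, h1, h2, h3, h4, h5⟩ := exists_colouring_succ col (by omega) hk hdeg hsum
    obtain ⟨col₂, h6, h7, h8⟩ := ih (n + 1) col₁ (by omega) h2 h3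
    refine ⟨col₂, fun x y j hx hy => ?_, h7, fun _ i hi => ?_⟩
    · rw [h6 x y j (by omega) (by omega), h1 x y j hx hy]
    · rcases Nat.eq_zero_or_pos m with rfl | hm
      · have := h5 rfl i hi
        rwa [← colourMatrix_congr h6 i] at this
      · exact h8 hm i (h4 (by omega) i hi)

/-! ### Multigraphs of maximal degree two as unions of paths and cycles. -/

section PathsAndCycles

variable {α β : Type*} {G C D : Graph α β} {x : α}

theorem mem_of_links {l : ℕ} {v : Fin (l + 1) → α} {T : Set α}
    (h : ∀ i : Fin l, v i.castSucc ∈ T ↔ v i.succ ∈ T) (a b : Fin (l + 1)) (ha : v a ∈ T) :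
    v b ∈ T := by
  have key : ∀ c, v c ∈ T ↔ v 0 ∈ T := by
    intro c
    induction c using Fin.induction with
    | zero => rfl
    | succ i ih => rw [← h i, ih]
  exact (key b).2 ((key a).1 ha)

theorem vertexSet_subset_of_closed (hC : IsPath C ∨ IsCycle C) {T : Set α}
    (hT : ∀ x y, C.Adj x y → x ∈ T → y ∈ T) {z : α} (hz : z ∈ V(C)) (hzT : z ∈ T) : V(C) ⊆ T := by
  have key : ∀ x y, C.Adj x y → (x ∈ T ↔ y ∈ T) := fun x y h => ⟨hT x y h, hT y x h.symm⟩
  rcases hC with ⟨l, v, e, -, -, hV, -, hl⟩ | ⟨l, v, e, -, -, hV, -, hl⟩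
  · rw [hV] at hz ⊢
    obtain ⟨a, rfl⟩ := hz
    rintro _ ⟨b, rfl⟩
    exact mem_of_links (fun i => key _ _ ⟨_, hl i⟩) a b hzT
  · rw [hV] at hz ⊢
    obtain ⟨a, rfl⟩ := hz
    rintro _ ⟨b, rfl⟩
    refine mem_of_links (fun i => key _ _ ⟨e i.castSucc, ?_⟩) a b hzT
    have := hl i.castSucc
    rwa [Fin.coeSucc_eq_succ] at this

theorem encard_image_le_one {ι : Type*} (e : ι → β) {s : Set ι} (hs : s.Subsingleton) :
    (e '' s).encard ≤ 1 :=
  Set.encard_le_one_iff_subsingleton.2 (hs.image e)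

theorem IsPath.encard_incidenceSet_le_two (hC : IsPath C) (x : α) :
    (C.incidenceSet x).encard ≤ 2 := by
  obtain ⟨l, v, e, hv, -, -, hE, hl⟩ := hC
  have hsub : C.incidenceSet x ⊆ e '' {i | v i.castSucc = x} ∪ e '' {i | v i.succ = x} := by
    intro f hf
    obtain ⟨i, rfl⟩ : f ∈ Set.range e := hE ▸ hf.edge_mem
    rcases hf.eq_or_eq_of_isLink (hl i) with h | h
    · exact Or.inl ⟨i, h.symm, rfl⟩
    · exact Or.inr ⟨i, h.symm, rfl⟩
  refine (Set.encard_le_encard hsub).trans ((Set.encard_union_le _ _).trans ?_)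
  rw [← one_add_one_eq_two]
  refine add_le_add (encard_image_le_one e fun i hi j hj => ?_)
    (encard_image_le_one e fun i hi j hj => ?_)
  · exact Fin.castSucc_injective _ (hv (hi.trans hj.symm))
  · exact Fin.succ_injective _ (hv (hi.trans hj.symm))

theorem IsPath.exists_encard_le_one (hC : IsPath C) :
    ∃ x ∈ V(C), (C.incidenceSet x).encard ≤ 1 := by
  obtain ⟨l, v, e, hv, -, hV, hE, hl⟩ := hC
  refine ⟨v 0, hV ▸ ⟨0, rfl⟩, ?_⟩
  have hsub : C.incidenceSet (v 0) ⊆ e '' {i | v i.castSucc = v 0} := by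
    intro f hf
    obtain ⟨i, rfl⟩ : f ∈ Set.range e := hE ▸ hf.edge_mem
    rcases hf.eq_or_eq_of_isLink (hl i) with h | h
    · exact ⟨i, h.symm, rfl⟩
    · exact absurd (hv h).symm (Fin.succ_ne_zero i)
  refine (Set.encard_le_encard hsub).trans (encard_image_le_one e fun i hi j hj => ?_)
  exact Fin.castSucc_injective _ (hv (hi.trans hj.symm))

theorem IsCycle.encard_incidenceSet_le_two (hC : IsCycle C) (x : α) :
    (C.incidenceSet x).encard ≤ 2 := by
  obtain ⟨l, v, e, hv, -, -, hE, hl⟩ := hC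
  have hsub : C.incidenceSet x ⊆ e '' {i | v i = x} ∪ e '' {i | v (i + 1) = x} := by
    intro f hf
    obtain ⟨i, rfl⟩ : f ∈ Set.range e := hE ▸ hf.edge_mem
    rcases hf.eq_or_eq_of_isLink (hl i) with h | h
    · exact Or.inl ⟨i, h.symm, rfl⟩
    · exact Or.inr ⟨i, h.symm, rfl⟩
  refine (Set.encard_le_encard hsub).trans ((Set.encard_union_le _ _).trans ?_)
  rw [← one_add_one_eq_two]
  refine add_le_add (encard_image_le_one e fun i hi j hj => ?_)
    (encard_image_le_one e fun i hi j hj => ?_)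
  · exact hv (hi.trans hj.symm)
  · exact add_right_cancel (hv (hi.trans hj.symm))

theorem IsCycle.two_le_encard_incidenceSet (hC : IsCycle C) (hloop : ∀ e x, ¬ C.IsLoopAt e x)
    (hx : x ∈ V(C)) : 2 ≤ (C.incidenceSet x).encard := by
  obtain ⟨l, v, e, hv, he, hV, hE, hl⟩ := hC
  rw [hV] at hx
  obtain ⟨a, rfl⟩ := hx
  have h1 : e a ∈ C.incidenceSet (v a) := (hl a).inc_left
  have h2 : e (a - 1) ∈ C.incidenceSet (v a) := by
    have := (hl (a - 1)).inc_right
    rwa [sub_add_cancel] at this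
  -- Equality forces `a = a - 1`, so the cycle has one vertex and its edge is a loop.
  have hne : e a ≠ e (a - 1) := by
    intro h
    have h3 : a + 1 = a := by
      nth_rewrite 1 [he h]
      exact sub_add_cancel _ _
    have := hl a
    rw [h3] at this
    exact hloop _ _ this
  rw [← Set.encard_pair hne]
  exact Set.encard_le_encard (Set.insert_subset h1 (Set.singleton_subset_iff.2 h2))

theorem incidenceSet_subset_of_union {S : Set (Graph α β)}
    (hS : ∀ C ∈ S, C ≤ G) (hdisj : S.Pairwise fun C D => Disjoint V(C) V(D))
    (hE : E(G) = ⋃ C ∈ S, E(C)) (hC : C ∈ S) (hx : x ∈ V(C)) :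
    G.incidenceSet x ⊆ C.incidenceSet x := by
  intro e he
  have h1 : e ∈ ⋃ C ∈ S, E(C) := hE ▸ he.edge_mem
  simp only [Set.mem_iUnion] at h1
  obtain ⟨D, hD, heD⟩ := h1
  have h2 : D.Inc e x := ((hS D hD).inc_congr heD).2 he
  have h3 : C = D := by
    by_contra hne
    exact Set.disjoint_left.1 (hdisj hC hD hne) hx h2.vertex_mem
  rwa [h3]

theorem IsUnionOfPathsAndCycles.encard_incidenceSet_le_two (hG : IsUnionOfPathsAndCycles G)
    (x : α) : (G.incidenceSet x).encard ≤ 2 := by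
  obtain ⟨S, hS, hdisj, hV, hE⟩ := hG
  by_cases hx : x ∈ V(G)
  · rw [hV] at hx
    simp only [Set.mem_iUnion] at hx
    obtain ⟨C, hC, hx⟩ := hx
    refine (Set.encard_le_encard
      (incidenceSet_subset_of_union (fun C h => (hS C h).1) hdisj hE hC hx)).trans ?_
    rcases (hS C hC).2 with h | h
    · exact h.encard_incidenceSet_le_two x
    · exact h.encard_incidenceSet_le_two x
  · have : G.incidenceSet x = ∅ := Set.eq_empty_of_forall_notMem fun e he => hx he.vertex_mem
    simp [this]

/-- Without cycles, the piece through a vertex of `U` is a path. It lies in `U`, and its first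
vertex has degree at most one. -/
theorem IsUnionOfPathsAndCycles.exists_encard_le_one (hG : IsUnionOfPathsAndCycles G)
    (hfree : IsCycleFree G) {U : Set α} (hne : (U ∩ V(G)).Nonempty)
    (hU : ∀ x y, G.Adj x y → x ∈ U → y ∈ U) : ∃ x ∈ U, (G.incidenceSet x).encard ≤ 1 := by
  obtain ⟨S, hS, hdisj, hV, hE⟩ := hG
  obtain ⟨x, hxU, hx⟩ := hne
  rw [hV] at hx
  simp only [Set.mem_iUnion] at hx
  obtain ⟨C, hC, hx⟩ := hx
  have hpath : IsPath C := (hS C hC).2.resolve_right (hfree C (hS C hC).1)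
  have hsub := vertexSet_subset_of_closed (Or.inl hpath)
    (fun x y h => hU x y (h.mono (hS C hC).1)) hx hxU
  obtain ⟨y, hy, hle⟩ := hpath.exists_encard_le_one
  exact ⟨y, hsub hy, (Set.encard_le_encard
    (incidenceSet_subset_of_union (fun C h => (hS C h).1) hdisj hE hC hy)).trans hle⟩

/-- The subgraph with prescribed sets of vertices and edges. -/
def subgraphOn (G : Graph α β) (X : Set α) (F : Set β) : Graph α β := (G.restrict F).induce X

theorem subgraphOn_isLink {X : Set α} {F : Set β} {e : β} {x y : α} :
    (subgraphOn G X F).IsLink e x y ↔ G.IsLink e x y ∧ e ∈ F ∧ x ∈ X ∧ y ∈ X := by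
  simp [subgraphOn, and_assoc]
  tauto

theorem subgraphOn_le {X : Set α} {F : Set β} (hX : X ⊆ V(G)) : subgraphOn G X F ≤ G :=
  ⟨hX, fun _ _ _ h => (subgraphOn_isLink.1 h).1⟩

theorem edgeSet_subgraphOn {X : Set α} {F : Set β}
    (hF : ∀ e ∈ F, ∃ x ∈ X, ∃ y ∈ X, G.IsLink e x y) : E(subgraphOn G X F) = F := by
  ext e
  rw [Graph.edgeSet_eq_setOfPred_exists_isLink]
  constructor
  · rintro ⟨x, y, h⟩
    exact (subgraphOn_isLink.1 h).2.1
  · intro he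
    obtain ⟨x, hx, y, hy, h⟩ := hF e he
    exact ⟨x, y, subgraphOn_isLink.2 ⟨h, he, hx, hy⟩⟩

/-- A path in `G`, given by the sequences of its vertices and edges. -/
structure IsPathSequence (G : Graph α β) {l : ℕ} (v : Fin (l + 1) → α) (e : Fin l → β) : Prop where
  inj : Function.Injective v
  mem : ∀ a, v a ∈ V(G)
  link : ∀ i : Fin l, G.IsLink (e i) (v i.castSucc) (v i.succ)

namespace IsPathSequence

variable {l : ℕ} {v : Fin (l + 1) → α} {e : Fin l → β}

theorem edge_injective (h : IsPathSequence G v e) : Function.Injective e := by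
  intro i j hij
  have h1 := h.link i
  rw [hij] at h1
  rcases h1.eq_and_eq_or_eq_and_eq (h.link j) with ⟨h2, -⟩ | ⟨h2, h3⟩
  · exact Fin.castSucc_injective _ (h.inj h2)
  · have h4 := congrArg Fin.val (h.inj h2)
    have h5 := congrArg Fin.val (h.inj h3)
    simp at h4 h5
    omega

theorem rev (h : IsPathSequence G v e) :
    IsPathSequence G (fun a => v a.rev) (fun i => e i.rev) where
  inj := h.inj.comp Fin.rev_injective
  mem a := h.mem _
  link i := by
    have := (h.link i.rev).symm
    rwa [← Fin.rev_castSucc, ← Fin.rev_succ] at this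

theorem cons (h : IsPathSequence G v e) {f : β} {y : α} (hf : G.IsLink f y (v 0))
    (hy : y ∉ Set.range v) :
    IsPathSequence G (Fin.cons y v : Fin (l + 1 + 1) → α) (Fin.cons f e : Fin (l + 1) → β) where
  inj := Fin.cons_injective_iff.2 ⟨hy, h.inj⟩
  mem a := by
    refine Fin.cases ?_ (fun a => ?_) a
    · simpa using hf.left_mem
    · simpa using h.mem a
  link i := by
    refine Fin.cases ?_ (fun i => ?_) i
    · simpa using hf
    · simpa [← Fin.succ_castSucc] using h.link i

theorem isPath_subgraphOn (h : IsPathSequence G v e) :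
    IsPath (subgraphOn G (Set.range v) (Set.range e)) := by
  refine ⟨l, v, e, h.inj, h.edge_injective, rfl, edgeSet_subgraphOn ?_, fun i => ?_⟩
  · rintro _ ⟨i, rfl⟩
    exact ⟨_, ⟨_, rfl⟩, _, ⟨_, rfl⟩, h.link i⟩
  · exact subgraphOn_isLink.2 ⟨h.link i, ⟨i, rfl⟩, ⟨_, rfl⟩, ⟨_, rfl⟩⟩

theorem isCycle_subgraphOn (h : IsPathSequence G v e) {f : β} 
    (hf : G.IsLink f (v (Fin.last l)) (v 0)) (hfe : f ∉ Set.range e) :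
    IsCycle (subgraphOn G (Set.range v) (insert f (Set.range e))) := by
  have hrange : insert f (Set.range e) = Set.range (Fin.snoc e f : Fin (l + 1) → β) := by
    rw [Fin.range_snoc]
  have hlink : ∀ i : Fin (l + 1),
      G.IsLink ((Fin.snoc e f : Fin (l + 1) → β) i) (v i) (v (i + 1)) := by
    intro i
    rcases Fin.eq_castSucc_or_eq_last i with ⟨i, rfl⟩ | rfl
    · rw [Fin.coeSucc_eq_succ, Fin.snoc_castSucc]; exact h.link i
    · rw [Fin.last_add_one, Fin.snoc_last]; exact hf
  rw [hrange]
  refine ⟨l, v, Fin.snoc e f, h.inj, Fin.snoc_injective_iff.2 ⟨h.edge_injective, hfe⟩, rfl,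
    edgeSet_subgraphOn ?_, fun i => ?_⟩
  · rintro _ ⟨i, rfl⟩
    exact ⟨_, ⟨_, rfl⟩, _, ⟨_, rfl⟩, hlink i⟩
  · exact subgraphOn_isLink.2 ⟨hlink i, ⟨i, rfl⟩, ⟨_, rfl⟩, ⟨_, rfl⟩⟩

end IsPathSequence

theorem eq_of_three_incident (hdeg : (G.incidenceSet x).encard ≤ 2) {a b c : β}
    (ha : G.Inc a x) (hb : G.Inc b x) (hc : G.Inc c x) (hab : a ≠ b) (hac : a ≠ c) : b = c := by
  by_contra hbc
  have h1 : ({a, b, c} : Set β).encard = 3 := Set.encard_eq_three.2 ⟨a, b, c, hab, hac, hbc, rfl⟩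
  have h2 : ({a, b, c} : Set β) ⊆ G.incidenceSet x := by
    rintro _ (rfl | rfl | rfl) <;> assumption
  have := (Set.encard_le_encard h2).trans hdeg
  rw [h1] at this
  exact absurd this (by decide)

namespace IsPathSequence

variable {l : ℕ} {v : Fin (l + 1) → α} {e : Fin l → β}

/-- An interior vertex already meets two path edges, leaving no room for a third edge. -/
theorem eq_zero_or_eq_last (h : IsPathSequence G v e) (hdeg : ∀ x, (G.incidenceSet x).encard ≤ 2)
    {f : β} (hf : f ∉ Set.range e) {a : Fin (l + 1)} (hfa : G.Inc f (v a)) :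
    a = 0 ∨ a = Fin.last l := by
  rcases Fin.eq_castSucc_or_eq_last a with ⟨i, rfl⟩ | rfl
  · left
    by_contra h0
    obtain ⟨j, hj⟩ := Fin.exists_succ_eq.2 h0
    have h1 := (h.link i).inc_left
    have h2 := (h.link j).inc_right
    rw [hj] at h2
    have := eq_of_three_incident (hdeg _) hfa h1 h2 (fun h => hf ⟨i, h.symm⟩)
      (fun h => hf ⟨j, h.symm⟩)
    have h3 := h.edge_injective this
    rw [h3] at hj
    have := congrArg Fin.val hj
    simp at this
  · exact Or.inr rfl

/-- A longest path either is a whole component or can be closed to a cycle that is one. -/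
theorem exists_closed_of_longest (h : IsPathSequence G v e)
    (hdeg : ∀ x, (G.incidenceSet x).encard ≤ 2) (hloop : ∀ e x, ¬ G.IsLoopAt e x)
    (hlong : ∀ (v' : Fin (l + 1 + 1) → α) (e' : Fin (l + 1) → β), IsPathSequence G v' e' →
      ¬ Set.range v ⊆ Set.range v') :
    ∃ F, (IsPath (subgraphOn G (Set.range v) F) ∨ IsCycle (subgraphOn G (Set.range v) F)) ∧
      subgraphOn G (Set.range v) F ≤c G := by
  have hle : ∀ F, subgraphOn G (Set.range v) F ≤ G := fun F =>
    subgraphOn_le (by rintro _ ⟨a, rfl⟩; exact h.mem a)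
  by_cases hcl : ∀ f a, G.Inc f (v a) → f ∈ Set.range e
  · refine ⟨Set.range e, Or.inl h.isPath_subgraphOn, .mk' (hle _) ?_⟩
    rintro f x hf ⟨a, rfl⟩
    rw [edgeSet_subgraphOn]
    · exact hcl f a hf
    · rintro _ ⟨i, rfl⟩
      exact ⟨_, ⟨_, rfl⟩, _, ⟨_, rfl⟩, h.link i⟩
  push Not at hcl
  obtain ⟨f, a, hfa, hfe⟩ := hcl
  -- A neighbour of an end off the path would lengthen it, at the front or, after reversal, at the
  -- back.
  have hmem : ∀ y, G.IsLink f y (v 0) ∨ G.IsLink f y (v (Fin.last l)) → y ∈ Set.range v := by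
    intro y hy
    by_contra hyv
    rcases hy with hy | hy
    · refine hlong _ _ (h.cons hy hyv) ?_
      rw [Fin.range_cons]
      exact Set.subset_insert _ _
    · have hr : Set.range (fun a : Fin (l + 1) => v a.rev) = Set.range v :=
        Fin.rev_surjective.range_comp v
      refine hlong _ _ (h.rev.cons (f := f) (y := y) (by simpa using hy) (by rwa [hr])) ?_
      rw [Fin.range_cons, hr]
      exact Set.subset_insert _ _
  have hf : G.IsLink f (v (Fin.last l)) (v 0) := by
    obtain ⟨y, hy⟩ := hfa
    obtain ⟨b, rfl⟩ : y ∈ Set.range v := by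
      refine hmem y ?_
      rcases h.eq_zero_or_eq_last hdeg hfe hy.inc_left with rfl | rfl
      · exact Or.inl hy.symm
      · exact Or.inr hy.symm
    rcases h.eq_zero_or_eq_last hdeg hfe hy.inc_left with rfl | rfl <;>
    rcases h.eq_zero_or_eq_last hdeg hfe hy.inc_right with rfl | rfl
    · exact absurd hy (hloop _ _)
    · exact hy.symm
    · exact hy
    · exact absurd hy (hloop _ _)
  refine ⟨insert f (Set.range e), Or.inr (h.isCycle_subgraphOn hf hfe), .mk' (hle _) ?_⟩
  rintro g x hg ⟨a, rfl⟩
  rw [edgeSet_subgraphOn]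
  · by_contra hgn
    have hgf : g ≠ f := fun h => hgn (Or.inl h)
    have hge : g ∉ Set.range e := fun h => hgn (Or.inr h)
    -- If `l = 0` then `f` is a loop. Otherwise each end meets a path edge and `f`, so a third edge
    -- `g` is impossible.
    obtain ⟨l, rfl⟩ : ∃ l', l = l' + 1 := by
      refine Nat.exists_eq_succ_of_ne_zero ?_
      rintro rfl
      exact hloop _ _ hf
    rcases h.eq_zero_or_eq_last hdeg hge hg with rfl | rfl
    · exact hgf (eq_of_three_incident (hdeg _) (h.link 0).inc_left hg hf.inc_right
        (fun h => hge ⟨_, h⟩) (fun h => hfe ⟨_, h⟩))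
    · exact hgf (eq_of_three_incident (hdeg _) (h.link (Fin.last l)).inc_right hg hf.inc_left
        (fun h => hge ⟨_, h⟩) (fun h => hfe ⟨_, h⟩))
  · rintro _ (rfl | ⟨i, rfl⟩)
    · exact ⟨_, ⟨_, rfl⟩, _, ⟨_, rfl⟩, hf⟩
    · exact ⟨_, ⟨_, rfl⟩, _, ⟨_, rfl⟩, h.link i⟩

end IsPathSequence

/-- Take a path longest among those through `x`; any lengthening that keeps its vertices still
passes through `x`. -/
theorem exists_closed_path_or_cycle (hfin : V(G).Finite)
    (hdeg : ∀ x, (G.incidenceSet x).encard ≤ 2) (hloop : ∀ e x, ¬ G.IsLoopAt e x) (hx : x ∈ V(G)) :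
    ∃ C, (IsPath C ∨ IsCycle C) ∧ C ≤c G ∧ x ∈ V(C) := by
  let L : Set ℕ := {l | ∃ (v : Fin (l + 1) → α) (e : Fin l → β), IsPathSequence G v e ∧
    x ∈ Set.range v}
  have h0 : 0 ∈ L := ⟨fun _ => x, Fin.elim0,
    ⟨fun a b _ => Subsingleton.elim (α := Fin 1) a b, fun _ => hx, fun i => i.elim0⟩, ⟨0, rfl⟩⟩
  have hbdd : BddAbove L := by
    refine ⟨V(G).ncard, ?_⟩
    rintro l ⟨v, e, h, -⟩
    have h1 : Set.range v ⊆ V(G) := by rintro _ ⟨a, rfl⟩; exact h.mem a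
    have h2 := Set.ncard_le_ncard h1 hfin
    rw [← Set.image_univ, Set.ncard_image_of_injective _ h.inj, Set.ncard_univ,
      Nat.card_eq_fintype_card, Fintype.card_fin] at h2
    omega
  obtain ⟨v, e, h, hxv⟩ := Nat.sSup_mem ⟨0, h0⟩ hbdd
  obtain ⟨F, hF, hcl⟩ := h.exists_closed_of_longest hdeg hloop (by
    intro v' e' h' hsub
    have := le_csSup hbdd (show sSup L + 1 ∈ L from ⟨v', e', h', hsub hxv⟩)
    omega)
  exact ⟨_, hF, hcl, hxv⟩

/-- A finite loopless multigraph of maximal degree two is a union of disjoint paths and cycles. -/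
theorem isUnionOfPathsAndCycles_of_encard_le_two (hfin : V(G).Finite)
    (hdeg : ∀ x, (G.incidenceSet x).encard ≤ 2) (hloop : ∀ e x, ¬ G.IsLoopAt e x) :
    IsUnionOfPathsAndCycles G := by
  have hsub : ∀ C D : Graph α β, (IsPath C ∨ IsCycle C) → C ≤c G → D ≤c G → ∀ z ∈ V(C),
      z ∈ V(D) → V(C) ⊆ V(D) := by
    intro C D hC hCG hDG z hzC hzD
    refine vertexSet_subset_of_closed hC (fun x y hxy hx => ?_) hzC hzD
    exact (hDG.mem_iff_of_adj (hxy.mono hCG.le)).1 hx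
  -- The pieces are all closed paths and cycles; connectedness makes two that meet have the same
  -- vertices, and closedness the same edges.
  refine ⟨{C | (IsPath C ∨ IsCycle C) ∧ C ≤c G}, fun C hC => ⟨hC.2.le, hC.1⟩, ?_, ?_, ?_⟩
  · rintro C ⟨hC, hCG⟩ D ⟨hD, hDG⟩ hne
    rw [Set.disjoint_left]
    intro z hzC hzD
    apply hne
    have hV : V(C) = V(D) := (hsub C D hC hCG hDG z hzC hzD).antisymm
      (hsub D C hD hDG hCG z hzD hzC)
    refine Graph.ext hV fun e x y => ⟨fun h => ?_, fun h => ?_⟩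
    · exact (hDG.isLink_congr (hV ▸ h.left_mem)).2 (h.mono hCG.le)
    · exact (hCG.isLink_congr (hV ▸ h.left_mem)).2 (h.mono hDG.le)
  · ext x
    simp only [Set.mem_iUnion]
    constructor
    · intro hx
      obtain ⟨C, hC, hCG, hxC⟩ := exists_closed_path_or_cycle hfin hdeg hloop hx
      exact ⟨C, ⟨hC, hCG⟩, hxC⟩
    · rintro ⟨C, hC, hxC⟩
      exact hC.2.le.vertexSet_mono hxC
  · ext e
    simp only [Set.mem_iUnion]
    constructor
    · intro he
      obtain ⟨x, y, hxy⟩ := G.exists_isLink_of_mem_edgeSet he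
      obtain ⟨C, hC, hCG, hxC⟩ := exists_closed_path_or_cycle hfin hdeg hloop hxy.left_mem
      exact ⟨C, ⟨hC, hCG⟩, ((hCG.isLink_congr hxC).2 hxy).edge_mem⟩
    · rintro ⟨C, hC, heC⟩
      exact Graph.IsSubgraph.edgeSet_mono hC.2.le heC

end PathsAndCycles

/-! ### Colour classes as graphs. -/

/-- The edges of colour `i` in a colouring of `μ K_N`. -/
def colourClass {k : ℕ} (μ N : ℕ) (col : Sym2 ℕ × ℕ → Fin k) (i : Fin k) :
    Graph ℕ (Sym2 ℕ × ℕ) := (completeMultigraph μ N).restrict {e | col e = i}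

section ColourClass

variable {k μ N : ℕ} {col : Sym2 ℕ × ℕ → Fin k} {i : Fin k}

theorem colourClass_isLink {e : Sym2 ℕ × ℕ} {x y : ℕ} : (colourClass μ N col i).IsLink e x y ↔
    col e = i ∧ e.1 = s(x, y) ∧ x ≠ y ∧ x < N ∧ y < N ∧ e.2 < μ := Iff.rfl

theorem colourClass_not_isLoopAt (e : Sym2 ℕ × ℕ) (x : ℕ) :
    ¬ (colourClass μ N col i).IsLoopAt e x :=
  fun h => (colourClass_isLink.1 h).2.2.1 rfl

theorem degree_colourClass (x : ℕ) :
    degree (colourClass μ N col i) x = ((colourClass μ N col i).incidenceSet x).encard := by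
  have : (colourClass μ N col i).loopSet x = ∅ :=
    Set.eq_empty_of_forall_notMem fun e he => colourClass_not_isLoopAt e x he
  rw [degree, this, Set.encard_empty, add_zero]

theorem encard_incidenceSet_colourClass (x : Fin N) :
    ((colourClass μ N col i).incidenceSet x).encard = (∑ y, colourMatrix μ N col i x y : ℕ) := by
  let P : Finset (Fin N × ℕ) := (Finset.univ ×ˢ Finset.range μ).filter
    (fun p => x ≠ p.1 ∧ col (s(x.1, p.1.1), p.2) = i)
  have h1 : (colourClass μ N col i).incidenceSet x =
      (fun p : Fin N × ℕ => (s(x.1, p.1.1), p.2)) '' P := by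
    ext ⟨z, j⟩
    simp only [Graph.mem_incidenceSet, Graph.Inc, colourClass_isLink, Set.mem_image, P,
      Finset.coe_filter, Set.mem_ofPred_eq, Finset.mem_product, Finset.mem_univ, true_and,
      Finset.mem_range, Prod.mk.injEq]
    constructor
    · rintro ⟨y, hc, rfl, hne, -, hy, hj⟩
      exact ⟨(⟨y, hy⟩, j), ⟨hj, fun h => hne (congrArg Fin.val h), hc⟩, rfl, rfl⟩
    · rintro ⟨⟨y, j'⟩, ⟨hj, hne, hc⟩, rfl, rfl⟩
      exact ⟨y, hc, rfl, fun h => hne (Fin.ext h), x.2, y.2, hj⟩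
  have h2 : Function.Injective (fun p : Fin N × ℕ => (s(x.1, p.1.1), p.2)) := by
    rintro ⟨y, j⟩ ⟨y', j'⟩ h
    simp only [Prod.mk.injEq] at h
    obtain ⟨h, rfl⟩ := h
    rw [Sym2.congr_right] at h
    rw [Fin.ext h]
  rw [h1, h2.encard_image, Set.encard_coe_eq_coe_finsetCard, Finset.card_filter,
    Finset.sum_product]
  congr 1
  refine Finset.sum_congr rfl fun y _ => ?_
  simp only [colourMatrix, multiplicity, Fin.val_inj]
  split_ifs with h
  · simp [h]
  · simp [h]

theorem two_mul_ncard_edgeSet_colourClass :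
    2 * E(colourClass μ N col i).ncard = ∑ x, ∑ y, colourMatrix μ N col i x y := by
  let P : Finset ((Fin N × Fin N) × ℕ) := (Finset.univ ×ˢ Finset.range μ).filter
    (fun p => p.1.1 < p.1.2 ∧ col (s(p.1.1.1, p.1.2.1), p.2) = i)
  let φ : (Fin N × Fin N) × ℕ → Sym2 ℕ × ℕ := fun p => (s(p.1.1.1, p.1.2.1), p.2)
  have h1 : E(colourClass μ N col i) = φ '' P := by
    ext ⟨z, j⟩
    rw [Graph.edgeSet_eq_setOfPred_exists_isLink]
    simp only [colourClass_isLink, Set.mem_image, P, φ,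
      Finset.coe_filter, Set.mem_ofPred_eq, Finset.mem_product, Finset.mem_univ, true_and,
      Finset.mem_range, Prod.mk.injEq]
    constructor
    · rintro ⟨x, y, hc, rfl, hne, hx, hy, hj⟩
      rcases lt_or_gt_of_ne hne with h | h
      · exact ⟨((⟨x, hx⟩, ⟨y, hy⟩), j), ⟨hj, h, hc⟩, rfl, rfl⟩
      · exact ⟨((⟨y, hy⟩, ⟨x, hx⟩), j), ⟨hj, h, by rwa [Sym2.eq_swap]⟩, Sym2.eq_swap, rfl⟩
    · rintro ⟨⟨⟨x, y⟩, j'⟩, ⟨hj, hlt, hc⟩, rfl, rfl⟩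
      exact ⟨x, y, hc, rfl, fun h => hlt.ne (Fin.ext h), x.2, y.2, hj⟩
  have h2 : Set.InjOn φ P := by
    rintro ⟨⟨x, y⟩, j⟩ h ⟨⟨x', y'⟩, j'⟩ h' heq
    simp only [P, Finset.coe_filter, Set.mem_ofPred_eq, φ, Prod.mk.injEq] at h h' heq
    obtain ⟨heq, rfl⟩ := heq
    rcases Sym2.eq_iff.1 heq with ⟨h3, h4⟩ | ⟨h3, h4⟩
    · rw [Fin.ext h3, Fin.ext h4]
    · have h5 := h.2.1
      have h6 := h'.2.1
      rw [Fin.lt_def] at h5 h6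
      omega
  have h3 : P.card = ∑ x, ∑ y, if x < y then colourMatrix μ N col i x y else 0 := by
    rw [Finset.card_filter, Finset.sum_product, Fintype.sum_prod_type]
    refine Finset.sum_congr rfl fun x _ => Finset.sum_congr rfl fun y _ => ?_
    simp only [colourMatrix, multiplicity, Fin.val_inj]
    split_ifs with h h'
    · exact absurd h' h.ne
    · simp [h]
    · simp [h]
  rw [h1, h2.ncard_image, Set.ncard_coe_finset, h3, two_mul]
  conv_lhs => arg 2; rw [Finset.sum_comm]
  simp only [← Finset.sum_add_distrib]
  refine Finset.sum_congr rfl fun x _ => Finset.sum_congr rfl fun y _ => ?_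
  rcases lt_trichotomy x y with h | rfl | h
  · simp [h, h.not_gt]
  · simp [colourMatrix_self]
  · simp [h, h.not_gt, colourMatrix_comm col i y x]

theorem colourClass_adj {x y : Fin N} :
    (colourClass μ N col i).Adj x y ↔ colourMatrix μ N col i x y ≠ 0 := by
  simp only [Graph.Adj, colourClass_isLink, colourMatrix, multiplicity, Fin.val_inj]
  constructor
  · rintro ⟨⟨z, j⟩, hc, hz, hne, -, -, hj⟩
    simp only at hz
    subst hz
    rw [if_neg fun h => hne (congrArg Fin.val h)]
    exact (Finset.card_pos.2 ⟨j, by simpa using ⟨hj, hc⟩⟩).ne'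
  · intro h
    split_ifs at h with hne
    · exact absurd rfl h
    · obtain ⟨j, hj⟩ := Finset.card_pos.1 (Nat.pos_of_ne_zero h)
      simp only [Finset.mem_filter, Finset.mem_range] at hj
      exact ⟨(s(x.1, y.1), j), hj.2, rfl, fun h => hne (Fin.ext h), x.2, y.2, hj.1⟩

theorem isDecomposition_colourClass :
    IsDecomposition (completeMultigraph μ N) (colourClass μ N col) := by
  refine ⟨fun i => ⟨Graph.restrict_le, rfl⟩, ?_, ?_⟩
  · ext e
    simp [colourClass]
  · intro i j hij
    rw [Set.disjoint_left]
    rintro e ⟨-, hi⟩ ⟨-, hj⟩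
    exact hij (hi.symm.trans hj)

/-- Disjointness makes the class containing an edge unique; labels that are not edges get colour 0.
Thus arbitrary decompositions reduce to colourings. -/
theorem exists_eq_colourClass (hk : 0 < k) {A : Fin k → Graph ℕ (Sym2 ℕ × ℕ)}
    (hA : IsDecomposition (completeMultigraph μ N) A) :
    ∃ col : Sym2 ℕ × ℕ → Fin k, A = colourClass μ N col := by
  obtain ⟨hle, hE, hdisj⟩ := hA
  have h1 : ∀ e, ∃ i : Fin k, ∀ j, e ∈ E(A j) → j = i := by
    intro e
    by_cases h : ∃ i, e ∈ E(A i)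
    · obtain ⟨i, hi⟩ := h
      refine ⟨i, fun j hj => ?_⟩
      by_contra hne
      exact Set.disjoint_left.1 (hdisj j i hne) hj hi
    · exact ⟨⟨0, hk⟩, fun j hj => absurd ⟨j, hj⟩ h⟩
  choose col hcol using h1
  refine ⟨col, funext fun i => Graph.ext (hle i).vertexSet_eq fun e x y => ⟨fun h => ?_, ?_⟩⟩
  · exact ⟨(hcol e i h.edge_mem).symm, h.mono (hle i).le⟩
  · rintro ⟨hc, h⟩
    have h2 : e ∈ ⋃ j, E(A j) := hE ▸ h.edge_mem
    obtain ⟨j, hj⟩ := Set.mem_iUnion.1 h2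
    have h3 : j = i := (hcol e j hj).trans hc
    subst h3
    exact ((hle j).le.isLink_iff hj).2 h

theorem colourClass_le_colourClass {n : ℕ} {col' : Sym2 ℕ × ℕ → Fin k} (hn : n ≤ N)
    (h : ∀ x y j, x < n → y < n → col' (s(x, y), j) = col (s(x, y), j)) (i : Fin k) :
    colourClass μ n col i ≤ colourClass μ N col' i := by
  refine ⟨fun x hx => lt_of_lt_of_le hx hn, ?_⟩
  rintro ⟨z, j⟩ x y hl
  obtain ⟨hc, hz, hne, hx, hy, hj⟩ := colourClass_isLink.1 hl
  simp only at hz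
  subst hz
  exact colourClass_isLink.2 ⟨(h x y j hx hy).trans hc, rfl, hne, hx.trans_le hn, hy.trans_le hn, hj⟩

theorem isUnionOfPathsAndCycles_colourClass_iff :
    IsUnionOfPathsAndCycles (colourClass μ N col i) ↔
      ∀ x, ∑ y, colourMatrix μ N col i x y ≤ 2 := by
  constructor
  · intro h x
    have := h.encard_incidenceSet_le_two x
    rw [encard_incidenceSet_colourClass] at this
    exact_mod_cast this
  · intro h
    refine isUnionOfPathsAndCycles_of_encard_le_two (Set.finite_lt_nat N) (fun x => ?_)
      colourClass_not_isLoopAt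
    by_cases hx : x < N
    · rw [encard_incidenceSet_colourClass (⟨x, hx⟩ : Fin N)]
      exact_mod_cast h ⟨x, hx⟩
    · have : (colourClass μ N col i).incidenceSet x = ∅ :=
        Set.eq_empty_of_forall_notMem fun e he => hx he.vertex_mem
      simp [this]

theorem isTwoFactorization_colourClass_iff :
    IsTwoFactorization (completeMultigraph μ N) (colourClass μ N col) ↔
      ∀ i x, ∑ y, colourMatrix μ N col i x y = 2 := by
  constructor
  · intro h i x
    have := (h.2 i).2 x x.2
    rw [degree_colourClass, encard_incidenceSet_colourClass] at this
    exact_mod_cast this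
  · refine fun h => ⟨isDecomposition_colourClass, fun i => ⟨isDecomposition_colourClass.1 i, ?_⟩⟩
    intro x hx
    rw [degree_colourClass, encard_incidenceSet_colourClass (⟨x, hx⟩ : Fin N), h i ⟨x, hx⟩]
    rfl

theorem hasNoFullPart_colourMatrix (hun : IsUnionOfPathsAndCycles (colourClass μ N col i))
    (hfree : IsCycleFree (colourClass μ N col i)) : HasNoFullPart (colourMatrix μ N col i) := by
  intro U hne hU
  obtain ⟨u, hu⟩ := hne
  obtain ⟨x, ⟨y, hy, rfl⟩, hx⟩ := hun.exists_encard_le_one hfree (U := Fin.val '' (U : Set (Fin N)))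
    ⟨u, ⟨u, hu, rfl⟩, u.2⟩ (by
      rintro _ y hxy ⟨x, hx, rfl⟩
      exact ⟨⟨y, hxy.right_mem⟩, hU x hx ⟨y, hxy.right_mem⟩ (colourClass_adj.1 hxy), rfl⟩)
  refine ⟨y, hy, ?_⟩
  rw [encard_incidenceSet_colourClass] at hx
  have : ∑ z, colourMatrix μ N col i y z ≤ 1 := by exact_mod_cast hx
  omega

theorem isConnected_colourClass (hN : 0 < N) (h : IsConnectedMatrix (colourMatrix μ N col i)) :
    IsConnected (colourClass μ N col i) := by
  classical
  refine ⟨⟨0, hN⟩, fun x hx y hy => ?_⟩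
  have := h (Finset.univ.filter fun z : Fin N =>
    Relation.ReflTransGen (colourClass μ N col i).Adj x z) ⟨⟨x, hx⟩, by simpa using .refl⟩ (by
      intro a ha b hab
      simp only [Finset.mem_filter, Finset.mem_univ, true_and] at ha ⊢
      exact ha.tail (colourClass_adj.2 hab))
  rw [Finset.filter_eq_self] at this
  exact this ⟨y, hy⟩ (Finset.mem_univ _)

/-- A connected 2-regular graph contains no cycle other than itself. -/
theorem isCycleFree_colourClass {n : ℕ} (hn : n < N)
    (hdeg : ∀ x, ∑ y, colourMatrix μ N col i x y = 2) (hconn : IsConnected (colourClass μ N col i)) :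
    IsCycleFree (colourClass μ n col i) := by
  intro C hC hcyc
  have hCN : C ≤ colourClass μ N col i :=
    hC.trans (colourClass_le_colourClass hn.le (fun _ _ _ _ _ => rfl) i)
  -- The cycle already uses both edges of the large class at each of its vertices, so it cannot be
  -- left by a walk.
  have hinc : ∀ x ∈ V(C), (colourClass μ N col i).incidenceSet x ⊆ C.incidenceSet x := by
    intro x hx
    have h1 : C.incidenceSet x ⊆ (colourClass μ N col i).incidenceSet x :=
      fun e he => Graph.Inc.mono hCN he
    have hxN : x < N := hCN.vertexSet_mono hx
    have h2 := encard_incidenceSet_colourClass (μ := μ) (col := col) (i := i) (⟨x, hxN⟩ : Fin N)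
    rw [hdeg] at h2
    have h3 := hcyc.two_le_encard_incidenceSet
      (fun e x h => colourClass_not_isLoopAt e x (h.mono hCN)) hx
    refine (Set.Finite.eq_of_subset_of_encard_le ?_ h1 ?_).ge
    · exact (Set.finite_of_encard_eq_coe h2).subset h1
    · rw [h2]; exact h3
  obtain ⟨z, hz⟩ : V(C).Nonempty := by
    obtain ⟨l, v, e, -, -, hV, -⟩ := hcyc
    exact ⟨v 0, hV ▸ ⟨0, rfl⟩⟩
  have key : ∀ y, Relation.ReflTransGen (colourClass μ N col i).Adj z y → y ∈ V(C) := by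
    intro y hy
    induction hy with
    | refl => exact hz
    | tail _ hab ih =>
      obtain ⟨e, he⟩ := hab
      have h1 : C.Inc e _ := hinc _ ih he.inc_left
      exact ((hCN.isLink_iff h1.edge_mem).2 he).right_mem
  have h1 : n ∈ V(C) := key n (hconn.2 z (hCN.vertexSet_mono hz) n hn)
  exact absurd (hC.vertexSet_mono h1) (lt_irrefl n)

end ColourClass

/-! ### Counting conditions and the main theorem. -/

/-- The degree lost on restriction goes to the `m` removed vertices, each absorbing at most 2. -/
theorem sum_colourMatrix_restrict {k μ n m : ℕ} {col : Sym2 ℕ × ℕ → Fin k} {i : Fin k}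
    (h : ∀ x, ∑ y, colourMatrix μ (n + m) col i x y = 2) :
    (∀ x, ∑ y, colourMatrix μ n col i x y ≤ 2) ∧
      2 * n ≤ ∑ x, ∑ y, colourMatrix μ n col i x y + 2 * m := by
  have h1 : ∀ x : Fin n, ∑ y, colourMatrix μ n col i x y +
      ∑ y : Fin m, colourMatrix μ (n + m) col i (Fin.castAdd m x) (Fin.natAdd n y) = 2 := by
    intro x
    rw [← h (Fin.castAdd m x), Fin.sum_univ_add]
    rfl
  refine ⟨fun x => by have := h1 x; omega, ?_⟩
  have h2 : ∑ x : Fin n, ∑ y : Fin m,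
      colourMatrix μ (n + m) col i (Fin.castAdd m x) (Fin.natAdd n y) ≤ 2 * m := by
    rw [Finset.sum_comm]
    have : ∀ y : Fin m, ∑ x : Fin n,
        colourMatrix μ (n + m) col i (Fin.castAdd m x) (Fin.natAdd n y) ≤ 2 := by
      intro y
      have := h (Fin.natAdd n y)
      rw [Fin.sum_univ_add] at this
      simp only [colourMatrix_comm col i (Fin.natAdd n y) (Fin.castAdd m _)] at this
      omega
    refine (Finset.sum_le_sum fun y _ => this y).trans ?_
    simp [mul_comm]
  have h3 := Finset.sum_congr rfl fun (x : Fin n) (_ : x ∈ Finset.univ) => h1 x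
  rw [Finset.sum_add_distrib] at h3
  simp at h3
  omega

theorem size_of_isTwoFactorization {k μ N : ℕ} {col : Sym2 ℕ × ℕ → Fin k} (hN : 0 < N)
    (h : ∀ i x, ∑ y, colourMatrix μ N col i x y = 2) : 2 * k + μ = μ * N := by
  rw [← sum_sum_colourMatrix col ⟨0, hN⟩]
  simp [h, mul_comm]

theorem size_iff {k μ n m : ℕ} :
    (k : ℚ) = (μ : ℚ) * ((n : ℚ) + (m : ℚ) - 1) / 2 ↔ 2 * k + μ = μ * (n + m) := by
  rw [eq_div_iff two_ne_zero]
  constructor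
  · intro h
    have : (2 * k + μ : ℚ) = μ * (n + m) := by linarith
    exact_mod_cast this
  · intro h
    have : (2 * k + μ : ℚ) = μ * (n + m) := by exact_mod_cast h
    linarith

theorem le_ncard_iff {k μ n m : ℕ} {col : Sym2 ℕ × ℕ → Fin k} {i : Fin k} :
    (n : ℤ) - (m : ℤ) ≤ (E(colourClass μ n col i).ncard : ℤ) ↔
      2 * n ≤ ∑ x, ∑ y, colourMatrix μ n col i x y + 2 * m := by
  rw [← two_mul_ncard_edgeSet_colourClass]
  omega

/-- Edges of `A` have both ends below `n` and labels below `lam ≤ μ`, so they survive the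
restriction. -/
theorem le_colourClass_of_le {k lam μ n m : ℕ} {col : Sym2 ℕ × ℕ → Fin k} {i : Fin k}
    (hlam : lam ≤ μ) {A : Graph ℕ (Sym2 ℕ × ℕ)} (hA : A ≤s completeMultigraph lam n)
    (h : A ≤ colourClass μ (n + m) col i) : A ≤ colourClass μ n col i := by
  refine ⟨fun x hx => hA.le.vertexSet_mono hx, fun e x y hl => ?_⟩
  obtain ⟨hc, hz, hne, -, -, -⟩ := colourClass_isLink.1 (hl.mono h)
  obtain ⟨-, -, hx, hy, hj⟩ := hl.mono hA.le
  exact colourClass_isLink.2 ⟨hc, hz, hne, hx, hy, hj.trans_le hlam⟩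

end Enclosing

theorem mainTheorem3 (k n m lam mu : ℕ) (hk : 0 < k) (hn : 0 < n) (hm : 0 < m)
    (hlam : 0 < lam) (hmu : lam < mu)
    (A : Fin k → Graph ℕ (Sym2 ℕ × ℕ))
    (hA : Enclosing.IsPathDecomposition (Enclosing.completeMultigraph lam n) A) :
    ((∃ F : Fin k → Graph ℕ (Sym2 ℕ × ℕ),
        Enclosing.IsTwoFactorization (Enclosing.completeMultigraph mu (n + m)) F ∧
        Enclosing.IsEnclosedIn A F) ↔
      (k : ℚ) = (mu : ℚ) * ((n : ℚ) + (m : ℚ) - 1) / 2 ∧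
      ∃ B : Fin k → Graph ℕ (Sym2 ℕ × ℕ),
        Enclosing.IsPathDecomposition (Enclosing.completeMultigraph mu n) B ∧
        Enclosing.IsEnclosedIn A B ∧
        ∀ i, (n : ℤ) - (m : ℤ) ≤ ((B i).edgeSet.ncard : ℤ)) ∧
    (Enclosing.IsStrongPathDecomposition (Enclosing.completeMultigraph lam n) A →
      ((∃ F : Fin k → Graph ℕ (Sym2 ℕ × ℕ),
          Enclosing.IsHamiltonianDecomposition (Enclosing.completeMultigraph mu (n + m)) F ∧
          Enclosing.IsEnclosedIn A F) ↔
        (k : ℚ) = (mu : ℚ) * ((n : ℚ) + (m : ℚ) - 1) / 2 ∧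
        ∃ B : Fin k → Graph ℕ (Sym2 ℕ × ℕ),
          Enclosing.IsStrongPathDecomposition (Enclosing.completeMultigraph mu n) B ∧
          Enclosing.IsEnclosedIn A B ∧
          ∀ i, (n : ℤ) - (m : ℤ) ≤ ((B i).edgeSet.ncard : ℤ))) := by
  open Enclosing in
  have necessity : ∀ col : Sym2 ℕ × ℕ → Fin k,
      IsTwoFactorization (completeMultigraph mu (n + m)) (colourClass mu (n + m) col) →
      IsEnclosedIn A (colourClass mu (n + m) col) →
      (k : ℚ) = (mu : ℚ) * ((n : ℚ) + (m : ℚ) - 1) / 2 ∧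
        IsPathDecomposition (completeMultigraph mu n) (colourClass mu n col) ∧
        IsEnclosedIn A (colourClass mu n col) ∧
        ∀ i, (n : ℤ) - (m : ℤ) ≤ (E(colourClass mu n col i).ncard : ℤ) := by
    intro col hF hAF
    rw [isTwoFactorization_colourClass_iff] at hF
    refine ⟨size_iff.2 (size_of_isTwoFactorization (by omega) hF),
      ⟨isDecomposition_colourClass, fun i => isUnionOfPathsAndCycles_colourClass_iff.2
        (sum_colourMatrix_restrict (hF i)).1⟩,
      fun i => le_colourClass_of_le hmu.le (hA.1.1 i) (hAF i), fun i => ?_⟩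
    exact le_ncard_iff.2 (sum_colourMatrix_restrict (hF i)).2
  have sufficiency : ∀ col : Sym2 ℕ × ℕ → Fin k,
      (k : ℚ) = (mu : ℚ) * ((n : ℚ) + (m : ℚ) - 1) / 2 →
      IsPathDecomposition (completeMultigraph mu n) (colourClass mu n col) →
      (∀ i, (n : ℤ) - (m : ℤ) ≤ (E(colourClass mu n col i).ncard : ℤ)) →
      ∃ col' : Sym2 ℕ × ℕ → Fin k,
        IsTwoFactorization (completeMultigraph mu (n + m)) (colourClass mu (n + m) col') ∧
        (∀ i, colourClass mu n col i ≤ colourClass mu (n + m) col' i) ∧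
        ∀ i, IsCycleFree (colourClass mu n col i) → IsConnected (colourClass mu (n + m) col' i) := by
    intro col hsize hB hcard
    obtain ⟨col', h1, h2, h3⟩ := exists_colouring_add (size_iff.1 hsize) m n col rfl
      (fun i => isUnionOfPathsAndCycles_colourClass_iff.1 (hB.2 i))
      (fun i => le_ncard_iff.1 (hcard i))
    exact ⟨col', isTwoFactorization_colourClass_iff.2 h2,
      colourClass_le_colourClass (by omega) h1, fun i hi => isConnected_colourClass (by omega)
        (h3 hm i (hasNoFullPart_colourMatrix (hB.2 i) hi))⟩
  refine ⟨⟨?_, ?_⟩, fun _ => ⟨?_, ?_⟩⟩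
  · rintro ⟨F, hF, hAF⟩
    obtain ⟨col, rfl⟩ := exists_eq_colourClass hk hF.1
    obtain ⟨h1, h2⟩ := necessity col hF hAF
    exact ⟨h1, _, h2⟩
  · rintro ⟨hsize, B, hB, hAB, hcard⟩
    obtain ⟨col, rfl⟩ := exists_eq_colourClass hk hB.1
    obtain ⟨col', h1, h2, -⟩ := sufficiency col hsize hB hcard
    exact ⟨_, h1, fun i => (hAB i).trans (h2 i)⟩
  · rintro ⟨F, ⟨hF, hconn⟩, hAF⟩
    obtain ⟨col, rfl⟩ := exists_eq_colourClass hk hF.1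
    obtain ⟨h1, h2, h3, h4⟩ := necessity col hF hAF
    refine ⟨h1, _, ⟨h2, fun i => ?_⟩, h3, h4⟩
    exact isCycleFree_colourClass (by omega) (isTwoFactorization_colourClass_iff.1 hF i) (hconn i)
  · rintro ⟨hsize, B, ⟨hB, hfree⟩, hAB, hcard⟩
    obtain ⟨col, rfl⟩ := exists_eq_colourClass hk hB.1
    obtain ⟨col', h1, h2, h3⟩ := sufficiency col hsize hB hcard
    exact ⟨_, ⟨h1, fun i => h3 i (hfree i)⟩, fun i => (hAB i).trans (h2 i)⟩
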